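/- **Theorem (approximation guarantee of the local search + Guided Random Greedy algorithm).** Let $\mathcal N$ be a ground set of $n\ge 1$ elements, $k\ge 1$ an integer, and $f\colon 2^{\mathcal N}\to\mathbb R_{\ge 0}$ a non-negative (not necessarily monotone) submodular function, i.e. $f(B\cup\{s\})-f(B)\le f(A\cup\{s\})-f(A)$ for all $A\subseteq B\subseteq\mathcal N$ and $s\in\mathcal N\setminus B$. The function $f$ is accessed by a value oracle: a query is a set $S\subseteq\mathcal N$ and is answered by $f(S)$. For parameters $\varepsilon\in(0,1)$ and $t_s\in[0,1]$, consider the following algorithm. 1. *Initial solution.* Compute by some fixed procedure a set $S_0$ with $|S_0|\le k$ and $f(S_0)\ge c\cdot\max_{|T|\le k}f(T)$, where $c\in(0,1]$ is a constant. 2. *Local search.* Starting from $S=S_0$, repeat: if $|S|<k$ and for some $u\notin S$ the set $S'=S\cup\{u\}$ satisfies $f(S')\ge(1+\varepsilon/k)f(S)$ and $f(S')>f(S)$, replace $S$ by $S'$; otherwise, if $|S|=k$ and such an improvement is given by some $S'=(S\setminus\{v\})\cup\{u\}$ with $u\notin S$, $v\in S$, replace $S$ by $S'$; otherwise, if it is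 given by some $S'=S\setminus\{v\}$ with $v\in S$, replace $S$ by $S'$; otherwise stop. Let $Z$ be the final set. 3. *Guided Random Greedy.* Let $A_0=\emptyset$. For $i=1,\dots,k$ let $V_i=\mathcal N\setminus(A_{i-1}\cup Z)$ if $i\le\lceil k t_s\rceil$ and $V_i=\mathcal N\setminus A_{i-1}$ otherwise. Let $M_i\subseteq V_i$ be a set of at most $k$ elements maximizing $\sum_{u\in M_i}\bigl(f(A_{i-1}\cup\{u\})-f(A_{i-1})\bigr)$. Choose each $u\in M_i$ with probability $1/k$, at most one element being chosen (with the remaining probability $1-|M_i|/k$ none is; equivalently, $M_i$ is padded to size $k$ with dummy elements that do not affect $f$), and let $A_i$ be $A_{i-1}$ together with the chosen element, if any. Let $A=A_k$. 4. Return the one of $Z$ and $A$ with the larger value of $f$. There exist a procedure for step 1 with a constant $c\in(0,1]$, a constant $t_s\in[0,1]$, a constant $\varepsilon_0\in(0,1)$ and, for every $\varepsilon\in(0,1)$, a constant $C_\varepsilon$ (none of these constants depending on $n$, $k$ or $f$) such that for all $n$, $k$, $f$ as above: * for every $\varepsilon\in(0,1)$, on every run the algorithm returns a set of size at most $k$ and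 makes at most $C_\varepsilon\, n k^2$ queries in total, i.e. $O_\varepsilon(nk^2)$; * for every $\varepsilon\in(0,\varepsilon_0]$, the returned random set $S$ satisfies $$\mathbb E[f(S)]\;\ge\;0.385\cdot\max_{T\subseteq\mathcal N,\ |T|\le k}f(T).$$ -/

import Mathlib

/-- A set function is submodular if marginal gains are diminishing. -/
def IsSubmodular {N : Type} [DecidableEq N] (f : Finset N → ℝ) : Prop :=
  ∀ A B : Finset N, A ⊆ B → ∀ s : N, s ∉ B → f (insert s B) - f B ≤ f (insert s A) - f A

/-- A randomized adaptive algorithm in the value oracle model over the ground set `N`, with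
results in `α`: it stops with a result, or asks the oracle for the value of a set and
continues according to the answer, or draws a uniformly random element of a set of size
`m + 1` and continues according to the outcome. -/
inductive OracleAlg (N α : Type) : Type
  | ret (a : α) : OracleAlg N α
  | query (S : Finset N) (next : ℝ → OracleAlg N α) : OracleAlg N α
  | uniform (m : ℕ) (next : Fin (m + 1) → OracleAlg N α) : OracleAlg N α

namespace OracleAlg

/-- Sequential composition: run the first algorithm and hand its result to the second. -/
def bind {N α β : Type} : OracleAlg N α → (α → OracleAlg N β) → OracleAlg N β
  | ret a, g => g a
  | query S next, g => query S fun x => bind (next x) g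
  | uniform m next, g => uniform m fun i => bind (next i) g

/-- The joint law of the result and of the number of oracle queries made, when the oracle
answers according to `f`. -/
noncomputable def run {N α : Type} (f : Finset N → ℝ) : OracleAlg N α → PMF (α × ℕ)
  | ret a => PMF.pure (a, 0)
  | query S next => (run f (next (f S))).map fun r => (r.1, r.2 + 1)
  | uniform m next => (PMF.uniformOfFintype (Fin (m + 1))).bind fun i => run f (next i)

/-- The expected value, with respect to `f`, of the random set returned by the algorithm. -/
noncomputable def expectedValue {N : Type} [Fintype N] (f : Finset N → ℝ)
    (a : OracleAlg N (Finset N)) : ℝ :=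
  ∑ S : Finset N, (((run f a).map Prod.fst) S).toReal * f S

/-! ### Local search -/

open Classical in
/-- Query the sets of the list one after the other until the first one whose value is
`good` is found; `none` if there is no such set. -/
noncomputable def findFirst {N : Type} (good : ℝ → Prop) :
    List (Finset N) → OracleAlg N (Option (Finset N))
  | [] => ret none
  | T :: Ts => query T fun x => if good x then ret (some T) else findFirst good Ts

/-- The sets that local search may move to from `S`, in the order in which they are tried:
additions if `|S| < k`, then swaps if `|S| = k`, then deletions. -/
def localMoves {N : Type} [Fintype N] [LinearOrder N] (k : ℕ) (S : Finset N) :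
    List (Finset N) :=
  (if S.card < k then (Sᶜ.sort (· ≤ ·)).map (fun u => insert u S) else []) ++
  (if S.card = k then
    (Sᶜ.sort (· ≤ ·)).flatMap fun u =>
      (S.sort (· ≤ ·)).map fun v => insert u (S.erase v)
    else []) ++
  (S.sort (· ≤ ·)).map fun v => S.erase v

/-- At most `m` rounds of local search from `S`. A round moves to the first set, in the order
of `localMoves`, that improves the value by a factor of at least `1 + ε / k`, and
the search stops if there is none. (The requirement `v < x` matters only if `v = 0`.) -/
noncomputable def localSearchRounds {N : Type} [Fintype N] [LinearOrder N] (ε : ℝ) (k : ℕ) :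
    ℕ → Finset N → OracleAlg N (Finset N)
  | 0, S => ret S
  | m + 1, S => query S fun v =>
      bind (findFirst (fun x => v < x ∧ (1 + ε / k) * v ≤ x) (localMoves k S)) fun o =>
        match o with
        | none => ret S
        | some T => localSearchRounds ε k m T

/-- Local search started at `S₀`, run until no move improves enough. Values strictly
increase along the search, so that it stops by itself before `2 ^ |N|` rounds are over. -/
noncomputable def localSearch {N : Type} [Fintype N] [LinearOrder N] (ε : ℝ) (k : ℕ)
    (S₀ : Finset N) : OracleAlg N (Finset N) :=
  localSearchRounds ε k (2 ^ Fintype.card N) S₀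

/-! ### Guided Random Greedy -/

/-- Query all `S + u` for `u` in the list, and return the marginal gains `f(S + u) - v`
(where `v` is the value of `S`). -/
def askGains {N : Type} [DecidableEq N] (S : Finset N) (v : ℝ) :
    List N → OracleAlg N (N → ℝ)
  | [] => ret fun _ => 0
  | u :: us => query (insert u S) fun x =>
      bind (askGains S v us) fun w => ret (Function.update w u (x - v))

theorem exists_bestSubset {N : Type} (k : ℕ) (V : Finset N) (w : N → ℝ) :
    ∃ M : Finset N, (M ⊆ V ∧ M.card ≤ k) ∧
      ∀ M' : Finset N, M' ⊆ V → M'.card ≤ k → ∑ u ∈ M', w u ≤ ∑ u ∈ M, w u := by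
  classical
  obtain ⟨M, hM, hmax⟩ := Finset.exists_max_image (V.powerset.filter fun M => M.card ≤ k)
    (fun M => ∑ u ∈ M, w u) ⟨∅, by simp⟩
  simp only [Finset.mem_filter, Finset.mem_powerset] at hM hmax
  exact ⟨M, hM, fun M' h1 h2 => hmax M' ⟨h1, h2⟩⟩

/-- A subset of `V` of size at most `k` that maximizes the sum of the weights `w`. -/
noncomputable def bestSubset {N : Type} (k : ℕ) (V : Finset N) (w : N → ℝ) : Finset N :=
  Classical.choose (exists_bestSubset k V w)

/-- One step of (guided) random greedy from the current set `S`: find a set `M` of at most `k`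
candidates in `V` with the largest sum of marginal gains, pad it to size `k` with dummy
elements of marginal gain zero, and add a uniformly random element of the padded set to `S`
(adding a dummy element means leaving `S` as it is). -/
noncomputable def greedyStep {N : Type} [LinearOrder N] (k : ℕ) (V S : Finset N) :
    OracleAlg N (Finset N) :=
  query S fun v =>
    bind (askGains S v (V.sort (· ≤ ·))) fun w =>
      uniform (k - 1) fun i =>
        match ((bestSubset k V w).sort (· ≤ ·))[i.val]? with
        | none => ret S
        | some u => ret (insert u S)

/-- The first `i` steps of Guided Random Greedy: the elements of `Z` are not available in
the first `⌈k * ts⌉` steps. -/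
noncomputable def guidedSteps {N : Type} [Fintype N] [LinearOrder N] (k : ℕ) (ts : ℝ)
    (Z : Finset N) : ℕ → OracleAlg N (Finset N)
  | 0 => ret ∅
  | i + 1 => bind (guidedSteps k ts Z i) fun S =>
      greedyStep k (if i + 1 ≤ ⌈(k : ℝ) * ts⌉₊ then (S ∪ Z)ᶜ else Sᶜ) S

/-- Guided Random Greedy with guiding set `Z` and flip point `ts`. -/
noncomputable def guidedRandomGreedy {N : Type} [Fintype N] [LinearOrder N] (k : ℕ) (ts : ℝ)
    (Z : Finset N) : OracleAlg N (Finset N) :=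
  guidedSteps k ts Z k

/-! ### The combined algorithm -/

/-- Compute an initial solution by `init`, improve it by local search to a set `Z`, run
Guided Random Greedy with guiding set `Z` to get a set `A`, and return the better of
`Z` and `A`. -/
noncomputable def warmup {N : Type} [Fintype N] [LinearOrder N]
    (init : OracleAlg N (Finset N)) (ε ts : ℝ) (k : ℕ) : OracleAlg N (Finset N) :=
  bind init fun S₀ =>
  bind (localSearch ε k S₀) fun Z =>
  bind (guidedRandomGreedy k ts Z) fun A =>
  query Z fun z =>
  query A fun a =>
  ret (if z ≤ a then A else Z)

end OracleAlg

/-!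
Fix an optimal set `T`, write `O = f T`, and let `Z` be the result of the local search,
`L = f (T ∩ Z)` and `U = f (T ∪ Z)`.

Local optimality bounds the value of `Z` from below in terms of `L` and `U`
(`IsLocalOpt.inter_le`, `IsLocalOpt.union_add_inter_le`): up to a factor `1 + ε`, both `L` and
`(L + U) / 2` are at most `f Z`. Thus, if `Z` is bad, then `L` and `U` are small.

Guided Random Greedy profits from small `L` and `U`. Put `q = 1 - 1 / k`. One step moves the
expected value of the current set `A` a `1 / k` fraction of the way to the value of `A ∪ D`, for any
feasible `D` whose new elements are available (`gain_le_mean_greedyStep`), and retains a fraction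
`q` of the value of `A ∪ X` for any fixed `X` (`mul_union_le_mean_greedyStep`). While `Z` is
avoided, submodularity turns the latter into
`𝔼 f (A ∪ X) ≥ f X - (1 - q ^ i) U` for both `X = T \ Z` and `X = T`
(`sub_le_mean_union_guidedSteps`). Solving the two resulting linear recurrences
(`le_mean_guidedSteps`, `le_mean_guidedSteps_add`) and using `f (T \ Z) ≥ O - L`, one gets
a bound `c O - l L - u U` for the expected value at the end, where `0 ≤ u ≤ l`. The extreme case is
`L = U = w`, with `w = (1 + ε) f Z`, and the claim reduces to the numerical inequality
`c ≥ 0.3851 (1 + l + u)` (`ratio_le`). With the flip point `3 / 8`, the largest ratio that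
the coefficients allow tends to about `0.3857` for `k → ∞`, so that a crude estimate suffices for
`k ≥ 100`; for smaller `k` the inequality is evaluated.

The initial solution has to be a constant-factor approximation on every run, with few queries.
A single pass over the ground set maintains two disjoint sets `A` and `B`, and adds an element to
the one where it gains more if it increases its value by a factor of at least `1 + 1 / k`. Since
`f T ≤ f (A ∪ T) + f (B ∪ T)` for disjoint `A`, `B`, such a pair has at least an eighth of
the value of any feasible set `T` on one of its sides (`StreamInv.union_le`); and the last `k`
elements added to a set keep at least half of its value (`Grows.le_two_mul_take`), since it has
doubled meanwhile.

Expectations are computed by a recursive operator `mean`, and everything that holds on every run by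
induction on the support of the law of the run. The local search makes `O(k / ε)` rounds of
`O(n k)` queries (`localSearch_queries_le`).
-/

namespace OracleAlg

/-! ### Runs of oracle algorithms -/

section Runs

variable {N α β : Type}

theorem mem_support_run_ret {f : Finset N → ℝ} {a : α} {r : α × ℕ} :
    r ∈ (run f (ret a : OracleAlg N α)).support ↔ r = (a, 0) := by
  simp [run]

theorem mem_support_run_query {f : Finset N → ℝ} {S : Finset N} {next : ℝ → OracleAlg N α}
    {r : α × ℕ} :
    r ∈ (run f (query S next)).support ↔
      ∃ r' ∈ (run f (next (f S))).support, r = (r'.1, r'.2 + 1) := by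
  simp only [run, PMF.support_map, Set.mem_image]
  exact ⟨fun ⟨a, h, e⟩ => ⟨a, h, e.symm⟩, fun ⟨a, h, e⟩ => ⟨a, h, e.symm⟩⟩

theorem mem_support_run_uniform {f : Finset N → ℝ} {m : ℕ} {next : Fin (m + 1) → OracleAlg N α}
    {r : α × ℕ} :
    r ∈ (run f (uniform m next)).support ↔ ∃ i, r ∈ (run f (next i)).support := by
  simp [run]

/-- A run of a sequential composition is a run of the first part followed by a run of the second;
the query counts add up. -/
theorem mem_support_run_bind {f : Finset N → ℝ} {a : OracleAlg N α} {g : α → OracleAlg N β}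
    {r : β × ℕ} :
    r ∈ (run f (bind a g)).support ↔
      ∃ s ∈ (run f a).support, ∃ t ∈ (run f (g s.1)).support, r = (t.1, s.2 + t.2) := by
  induction a generalizing r with
  | ret a =>
    simp only [bind, mem_support_run_ret]
    constructor
    · intro h
      exact ⟨_, rfl, r, h, by simp⟩
    · rintro ⟨_, rfl, t, ht, rfl⟩
      simpa using ht
  | query S next ih =>
    simp only [bind, mem_support_run_query, ih]
    constructor
    · rintro ⟨_, ⟨s, hs, t, ht, rfl⟩, rfl⟩
      exact ⟨_, ⟨s, hs, rfl⟩, t, ht, by simp; omega⟩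
    · rintro ⟨_, ⟨s, hs, rfl⟩, t, ht, rfl⟩
      exact ⟨_, ⟨s, hs, t, ht, rfl⟩, by simp; omega⟩
  | uniform m next ih =>
    simp only [bind, mem_support_run_uniform, ih]
    constructor
    · rintro ⟨i, s, hs, h⟩
      exact ⟨s, ⟨i, hs⟩, h⟩
    · rintro ⟨s, ⟨i, hs⟩, h⟩
      exact ⟨i, s, hs, h⟩

/-- The expectation of `φ` of the result of an algorithm, by recursion on the algorithm. -/
noncomputable def mean (f : Finset N → ℝ) : OracleAlg N α → (α → ℝ) → ℝ
  | ret a, φ => φ a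
  | query S next, φ => mean f (next (f S)) φ
  | uniform m next, φ => (∑ i, mean f (next i) φ) / (m + 1)

theorem sum_map_run_eq_mean [Fintype α] (f : Finset N → ℝ) (a : OracleAlg N α)
    (φ : α → ℝ) :
    ∑ S, (((run f a).map Prod.fst) S).toReal * φ S = mean f a φ := by
  classical
  induction a with
  | ret a =>
    simp only [run, mean, PMF.pure_map, PMF.pure_apply]
    rw [Finset.sum_eq_single a]
    · simp
    · intro b _ hb; simp [hb]
    · simp
  | query S next ih =>
    simp only [run, mean, PMF.map_comp]
    exact ih (f S)
  | uniform m next ih =>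
    simp only [run, mean, ← ih, PMF.map_bind, PMF.bind_apply, tsum_fintype]
    rw [Finset.sum_comm, Finset.sum_div]
    refine Finset.sum_congr rfl fun S _ => ?_
    rw [ENNReal.toReal_sum (fun i _ => ENNReal.mul_ne_top (PMF.apply_ne_top _ _)
      (PMF.apply_ne_top _ _)), Finset.sum_mul, Finset.sum_div]
    refine Finset.sum_congr rfl fun i _ => ?_
    simp only [PMF.uniformOfFintype_apply, Fintype.card_fin, ENNReal.toReal_mul,
      ENNReal.toReal_inv, Nat.cast_add, Nat.cast_one]
    rw [ENNReal.toReal_add (by simp) (by simp)]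
    simp only [ENNReal.toReal_natCast, ENNReal.toReal_one]
    field_simp

theorem expectedValue_eq_mean [Fintype N] (f : Finset N → ℝ) (a : OracleAlg N (Finset N)) :
    a.expectedValue f = mean f a f :=
  sum_map_run_eq_mean f a f

theorem mean_bind (f : Finset N → ℝ) (a : OracleAlg N α) (g : α → OracleAlg N β) (φ : β → ℝ) :
    mean f (bind a g) φ = mean f a fun x => mean f (g x) φ := by
  induction a with
  | ret a => rfl
  | query S next ih => exact ih _
  | uniform m next ih => simp only [bind, mean, ih]

theorem mean_const (f : Finset N → ℝ) (a : OracleAlg N α) (c : ℝ) :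
    mean f a (fun _ => c) = c := by
  induction a with
  | ret a => rfl
  | query S next ih => exact ih _
  | uniform m next ih =>
    simp only [mean, ih, Finset.sum_const, Finset.card_univ, Fintype.card_fin, nsmul_eq_mul]
    push_cast
    field_simp

theorem mean_add (f : Finset N → ℝ) (a : OracleAlg N α) (φ ψ : α → ℝ) :
    mean f a (fun x => φ x + ψ x) = mean f a φ + mean f a ψ := by
  induction a with
  | ret a => rfl
  | query S next ih => exact ih _
  | uniform m next ih => simp only [mean, ih, Finset.sum_add_distrib, add_div]

theorem mean_const_mul (f : Finset N → ℝ) (a : OracleAlg N α) (c : ℝ) (φ : α → ℝ) :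
    mean f a (fun x => c * φ x) = c * mean f a φ := by
  induction a with
  | ret a => rfl
  | query S next ih => exact ih _
  | uniform m next ih => simp only [mean, ih, ← Finset.mul_sum, mul_div_assoc]

/-- Expectation is monotone; the inequality is needed only for results that can occur. -/
theorem mean_mono {f : Finset N → ℝ} {a : OracleAlg N α} {φ ψ : α → ℝ}
    (h : ∀ r ∈ (run f a).support, φ r.1 ≤ ψ r.1) : mean f a φ ≤ mean f a ψ := by
  induction a with
  | ret a => exact h (a, 0) (mem_support_run_ret.2 rfl)
  | query S next ih =>
    exact ih _ fun r hr => h (r.1, r.2 + 1) (mem_support_run_query.2 ⟨r, hr, rfl⟩)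
  | uniform m next ih =>
    simp only [mean]
    gcongr with i
    exact ih i fun r hr => h r (mem_support_run_uniform.2 ⟨i, hr⟩)

theorem le_mean {f : Finset N → ℝ} {a : OracleAlg N α} {φ : α → ℝ} {c : ℝ}
    (h : ∀ r ∈ (run f a).support, c ≤ φ r.1) : c ≤ mean f a φ := by
  simpa only [mean_const] using mean_mono (φ := fun _ => c) h

end Runs

end OracleAlg

/-! ### Submodular functions -/

namespace IsSubmodular

variable {N : Type} [DecidableEq N] {f : Finset N → ℝ}

/-- The marginal gain of a set is at most the sum of the marginal gains of its elements. -/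
theorem union_sub_le_sum (hf : IsSubmodular f) (S D : Finset N) :
    f (S ∪ D) - f S ≤ ∑ u ∈ D, (f (insert u S) - f S) := by
  induction D using Finset.induction_on with
  | empty => simp
  | insert u D hu ih =>
    rw [Finset.sum_insert hu, Finset.union_insert]
    by_cases hS : u ∈ S
    · rw [Finset.insert_eq_of_mem (Finset.mem_union_left D hS), Finset.insert_eq_of_mem hS]
      linarith
    · have h := hf S (S ∪ D) Finset.subset_union_left u (by simp [hu, hS])
      linarith

/-- Removing the elements of `D` one at a time from `S` loses at least what removing each of them
alone loses. -/
theorem sum_erase_le (hf : IsSubmodular f) (S D : Finset N) (hD : D ⊆ S) :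
    ∑ v ∈ D, (f S - f (S.erase v)) ≤ f S - f (S \ D) := by
  induction D using Finset.induction_on with
  | empty => simp
  | insert u D hu ih =>
    rw [Finset.insert_subset_iff] at hD
    rw [Finset.sum_insert hu]
    have h := hf (S \ insert u D) (S.erase u) (by
      intro x; simp only [Finset.mem_sdiff, Finset.mem_insert, Finset.mem_erase]; tauto) u
      (by simp)
    rw [Finset.insert_erase hD.1] at h
    have e : insert u (S \ insert u D) = S \ D := by
      ext x
      simp only [Finset.mem_sdiff, Finset.mem_insert]
      by_cases hx : x = u
      · subst hx; simp [hu, hD.1]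
      · simp [hx]
    rw [e] at h
    linarith [ih hD.2]

theorem union_add_inter_le (hf : IsSubmodular f) (A B : Finset N) :
    f (A ∪ B) + f (A ∩ B) ≤ f A + f B := by
  suffices H : ∀ D : Finset N, Disjoint A D → ∀ X ⊆ A, f (A ∪ D) + f X ≤ f A + f (X ∪ D) by
    have h := H (B \ A) Finset.disjoint_sdiff (A ∩ B) Finset.inter_subset_left
    have e : A ∩ B ∪ B \ A = B := by
      ext x; simp only [Finset.mem_union, Finset.mem_inter, Finset.mem_sdiff]; tauto
    rwa [Finset.union_sdiff_self_eq_union, e] at h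
  intro D hD X hX
  induction D using Finset.induction_on with
  | empty => simp
  | insert u D hu ih =>
    rw [Finset.disjoint_insert_right] at hD
    rw [Finset.union_insert, Finset.union_insert]
    have h := hf (X ∪ D) (A ∪ D) (Finset.union_subset_union_left hX) u (by simp [hu, hD.1])
    linarith [ih hD.2]

theorem union_le_add (hf : IsSubmodular f) (h0 : ∀ S, 0 ≤ f S) (A B : Finset N) :
    f (A ∪ B) ≤ f A + f B := by
  linarith [hf.union_add_inter_le A B, h0 (A ∩ B)]

/-- Diminishing returns for the marginal gain of an element, without the condition that the
element be new: a negative gain turns into zero. -/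
theorem gain_le_max (hf : IsSubmodular f) {A B : Finset N} (hAB : A ⊆ B) (u : N) :
    f (insert u B) - f B ≤ max (f (insert u A) - f A) 0 := by
  by_cases hu : u ∈ B
  · simp [Finset.insert_eq_of_mem hu]
  · exact le_max_of_le_left (hf A B hAB u hu)

end IsSubmodular

namespace OracleAlg

/-! ### Local search -/

theorem findFirst_spec {N : Type} (f : Finset N → ℝ) (good : ℝ → Prop) (l : List (Finset N))
    {r : Option (Finset N) × ℕ} (hr : r ∈ (run f (findFirst good l)).support) :
    r.2 ≤ l.length ∧ (∀ T, r.1 = some T → T ∈ l ∧ good (f T)) ∧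
      (r.1 = none → ∀ T ∈ l, ¬ good (f T)) := by
  induction l generalizing r with
  | nil =>
    rw [findFirst, mem_support_run_ret] at hr
    subst hr
    simp
  | cons T l ih =>
    rw [findFirst, mem_support_run_query] at hr
    obtain ⟨s, hs, rfl⟩ := hr
    split_ifs at hs with hT
    · rw [mem_support_run_ret] at hs
      subst hs
      simp only [List.length_cons, Option.some.injEq, List.mem_cons]
      exact ⟨by omega, by rintro _ rfl; exact ⟨Or.inl rfl, hT⟩, by simp⟩
    · obtain ⟨h1, h2, h3⟩ := ih hs
      refine ⟨by simpa using h1, fun U hU => ?_, fun h U hU => ?_⟩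
      · exact ⟨List.mem_cons_of_mem _ (h2 U hU).1, (h2 U hU).2⟩
      · rcases List.mem_cons.1 hU with rfl | hU
        · exact hT
        · exact h3 h U hU

section LocalSearch

variable {N : Type} [Fintype N] [LinearOrder N]

theorem mem_localMoves {k : ℕ} {S T : Finset N} :
    T ∈ localMoves k S ↔
      (S.card < k ∧ ∃ u, u ∉ S ∧ insert u S = T) ∨
      (S.card = k ∧ ∃ u, u ∉ S ∧ ∃ v ∈ S, insert u (S.erase v) = T) ∨
      ∃ v ∈ S, S.erase v = T := by
  unfold localMoves
  simp only [List.mem_append, or_assoc, List.mem_map, Finset.mem_sort]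
  refine or_congr ?_ (or_congr ?_ Iff.rfl)
  · split_ifs with h <;> simp [h]
  · split_ifs with h <;> simp [h]

theorem card_le_of_mem_localMoves {k : ℕ} {S T : Finset N} (hS : S.card ≤ k)
    (hT : T ∈ localMoves k S) : T.card ≤ k := by
  rcases mem_localMoves.1 hT with ⟨h, u, hu, rfl⟩ | ⟨h, u, hu, v, hv, rfl⟩ | ⟨v, hv, rfl⟩
  · rw [Finset.card_insert_of_notMem hu]; omega
  · have := Finset.card_insert_le u (S.erase v)
    have := Finset.card_erase_add_one hv
    omega
  · exact (Finset.card_le_card (Finset.erase_subset v S)).trans hS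

theorem length_localMoves_le (k : ℕ) (S : Finset N) :
    (localMoves k S).length ≤ Fintype.card N * (k + 2) := by
  unfold localMoves
  have h1 : Sᶜ.card ≤ Fintype.card N := Finset.card_le_univ _
  have h2 : S.card ≤ Fintype.card N := Finset.card_le_univ _
  simp only [List.length_append, List.length_map, Finset.length_sort]
  have a : (if S.card < k then (Sᶜ.sort (· ≤ ·)).map (fun u => insert u S) else []).length
      ≤ Fintype.card N := by
    split_ifs <;> simp [h1]
  have b : (if S.card = k then (Sᶜ.sort (· ≤ ·)).flatMap fun u =>
      (S.sort (· ≤ ·)).map fun v => insert u (S.erase v) else []).length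
      ≤ Fintype.card N * k := by
    split_ifs with h
    · simp only [List.length_flatMap, List.length_map, Finset.length_sort, List.map_const',
        List.sum_replicate, smul_eq_mul, h]
      exact Nat.mul_le_mul_right _ h1
    · simp
  nlinarith

/-- No local move improves the value by a factor of `1 + ε / k`. -/
def IsLocalOpt (f : Finset N → ℝ) (ε : ℝ) (k : ℕ) (Z : Finset N) : Prop :=
  ∀ T ∈ localMoves k Z, ¬ (f Z < f T ∧ (1 + ε / k) * f Z ≤ f T)

/-- Every round improves the value by a factor of `1 + ε / k`, and the search ends in a local
optimum as soon as more rounds are allowed than there are sets of larger value. -/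
theorem localSearchRounds_spec {f : Finset N → ℝ} {ε : ℝ} {k : ℕ} (hε : 0 ≤ ε)
    (m : ℕ) (S : Finset N) (hS : S.card ≤ k)
    {r : Finset N × ℕ} (hr : r ∈ (run f (localSearchRounds ε k m S)).support) :
    r.1.card ≤ k ∧
    (∃ j : ℕ, r.2 ≤ (j + 1) * (1 + Fintype.card N * (k + 2)) ∧
      (1 + ε / k) ^ j * f S ≤ f r.1 ∧ (j = 0 ∨ f S < f r.1)) ∧
    ((Finset.univ.filter fun T => f S < f T).card < m → IsLocalOpt f ε k r.1) := by
  induction m generalizing S r with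
  | zero =>
    rw [localSearchRounds, mem_support_run_ret] at hr
    subst hr
    exact ⟨hS, ⟨0, by simp, by simp, Or.inl rfl⟩, by simp⟩
  | succ m ih =>
    rw [localSearchRounds, mem_support_run_query] at hr
    obtain ⟨_, hr', rfl⟩ := hr
    rw [mem_support_run_bind] at hr'
    obtain ⟨⟨o, c⟩, ho, t, ht, rfl⟩ := hr'
    obtain ⟨hc, hsome, hnone⟩ := findFirst_spec f _ _ ho
    have hlen := length_localMoves_le k S
    dsimp only at hc ht hsome hnone ⊢
    match o with
    | none =>
      rw [mem_support_run_ret] at ht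
      subst ht
      exact ⟨hS, ⟨0, by dsimp only; omega, by simp, Or.inl rfl⟩, fun _ => hnone rfl⟩
    | some T =>
      obtain ⟨hT, hlt, hge⟩ := hsome T rfl
      obtain ⟨h1, ⟨j, hj1, hj2, hj3⟩, h3⟩ := ih T (card_le_of_mem_localMoves hS hT) ht
      have hST : f S < f t.1 := by
        rcases hj3 with rfl | hj3
        · exact hlt.trans_le (by simpa using hj2)
        · exact hlt.trans hj3
      refine ⟨h1, ⟨j + 1, ?_, ?_, Or.inr hST⟩, fun hm => h3 ?_⟩
      · calc c + t.2 + 1 ≤ (j + 1) * (1 + Fintype.card N * (k + 2)) +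
            (1 + Fintype.card N * (k + 2)) := by omega
          _ = _ := by ring
      · rw [pow_succ, mul_assoc]
        refine le_trans ?_ hj2
        gcongr
      · refine lt_of_lt_of_le (Finset.card_lt_card ?_) (Nat.lt_succ_iff.1 hm)
        refine Finset.ssubset_iff_subset_ne.2 ⟨fun U hU => ?_, fun e => ?_⟩
        · simp only [Finset.mem_filter, Finset.mem_univ, true_and] at hU ⊢
          exact hlt.trans hU
        · have : T ∈ Finset.univ.filter fun U => f S < f U := by simpa using hlt
          rw [← e] at this
          simp at this

theorem localSearch_spec {f : Finset N → ℝ} {ε : ℝ} {k : ℕ} (hε : 0 ≤ ε)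
    {S : Finset N} (hS : S.card ≤ k)
    {r : Finset N × ℕ} (hr : r ∈ (run f (localSearch ε k S)).support) :
    r.1.card ≤ k ∧ IsLocalOpt f ε k r.1 ∧
    ∃ j : ℕ, r.2 ≤ (j + 1) * (1 + Fintype.card N * (k + 2)) ∧
      (1 + ε / k) ^ j * f S ≤ f r.1 ∧ (j = 0 ∨ f S < f r.1) := by
  obtain ⟨h1, h2, h3⟩ := localSearchRounds_spec hε _ S hS hr
  refine ⟨h1, h3 ?_, h2⟩
  rw [← Fintype.card_finset]
  refine (Finset.card_lt_card ?_).trans_eq Finset.card_univ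
  exact Finset.filter_ssubset.2 ⟨S, Finset.mem_univ S, lt_irrefl _⟩

/-- Starting from a constant-factor approximation, local search makes `O(k / ε)` rounds: by
Bernoulli's inequality the value gains a constant factor in `k / ε` rounds. -/
theorem localSearch_queries_le {f : Finset N → ℝ} (h0 : ∀ S, 0 ≤ f S) {ε c : ℝ} {k : ℕ}
    (hk : 1 ≤ k) (hε : 0 < ε) (hc : 0 < c) {S : Finset N} (hS : S.card ≤ k)
    (happ : ∀ T : Finset N, T.card ≤ k → c * f T ≤ f S)
    {r : Finset N × ℕ} (hr : r ∈ (run f (localSearch ε k S)).support) :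
    (r.2 : ℝ) ≤ (k / (ε * c) + 1) * (1 + Fintype.card N * (k + 2)) := by
  obtain ⟨h1, -, j, hj, hj2, hj3⟩ := localSearch_spec hε.le hS hr
  have hk' : (0 : ℝ) < k := by exact_mod_cast hk
  have hjle : (j : ℝ) ≤ k / (ε * c) := by
    rcases hj3 with rfl | hj3
    · simp only [Nat.cast_zero]; positivity
    · have hT := happ r.1 h1
      have hpos : 0 < f S :=
        lt_of_lt_of_le (mul_pos hc ((h0 S).trans_lt hj3)) hT
      have hb : 1 + j * (ε / k) ≤ (1 + ε / k) ^ j :=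
        one_add_mul_le_pow (by have : 0 ≤ ε / k := by positivity
                               linarith) j
      have h2 : (1 + j * (ε / k)) * f S * c ≤ f S := by
        have := (mul_le_mul_of_nonneg_right hb hpos.le).trans hj2
        nlinarith
      have h3 : (1 + j * (ε / k)) * c ≤ 1 := by
        by_contra! h
        nlinarith
      rw [le_div_iff₀ (by positivity)]
      have h4 : j * (ε / k) * c ≤ 1 := by nlinarith
      have h5 : j * (ε / k) * c = j * (ε * c) / k := by ring
      rw [h5, div_le_one hk'] at h4
      exact h4
  calc (r.2 : ℝ) ≤ (j + 1) * (1 + Fintype.card N * (k + 2)) := by exact_mod_cast hj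
    _ ≤ _ := by gcongr

end LocalSearch

section LocalOpt

variable {N : Type} [Fintype N] [LinearOrder N] {f : Finset N → ℝ} {ε : ℝ} {k : ℕ}
  {Z : Finset N}

theorem IsLocalOpt.le (h : IsLocalOpt f ε k Z) (h0 : ∀ S, 0 ≤ f S) (hε : 0 ≤ ε)
    {T : Finset N} (hT : T ∈ localMoves k Z) : f T ≤ f Z + ε / k * f Z := by
  by_contra! hlt
  have : 0 ≤ ε / k * f Z := mul_nonneg (by positivity) (h0 Z)
  exact h T hT ⟨by linarith, by linarith⟩

theorem IsLocalOpt.inter_le (h : IsLocalOpt f ε k Z) (hf : IsSubmodular f) (h0 : ∀ S, 0 ≤ f S)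
    (hε : 0 ≤ ε) (hk : 1 ≤ k) (hZ : Z.card ≤ k) (T : Finset N) :
    f (Z ∩ T) ≤ (1 + ε) * f Z := by
  have hk' : (0 : ℝ) < k := by exact_mod_cast hk
  have h1 := hf.sum_erase_le Z (Z \ T) Finset.sdiff_subset
  rw [sdiff_sdiff_right_self, Finset.inf_eq_inter] at h1
  have h2 : ∑ v ∈ Z \ T, (-(ε / k * f Z)) ≤ ∑ v ∈ Z \ T, (f Z - f (Z.erase v)) := by
    refine Finset.sum_le_sum fun v hv => ?_
    have := h.le h0 hε (T := Z.erase v)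
      (mem_localMoves.2 (Or.inr (Or.inr ⟨v, (Finset.mem_sdiff.1 hv).1, rfl⟩)))
    linarith
  have h3 : ((Z \ T).card : ℝ) * (ε / k * f Z) ≤ k * (ε / k * f Z) := by
    have : (Z \ T).card ≤ k := (Finset.card_le_card Finset.sdiff_subset).trans hZ
    have h5 : 0 ≤ ε / k * f Z := mul_nonneg (by positivity) (h0 Z)
    exact mul_le_mul_of_nonneg_right (by exact_mod_cast this) h5
  have h4 : k * (ε / k * f Z) = ε * f Z := by field_simp
  rw [Finset.sum_const, nsmul_eq_mul] at h2
  linarith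

/-- The key property of a local optimum `Z`: the two sets `Z ∪ T` and `Z ∩ T` have, on average,
at most about the value of `Z`. If `Z` is full, each element of `T \ Z` is matched with
an element of `Z \ T` to form a swap. -/
theorem IsLocalOpt.union_add_inter_le (h : IsLocalOpt f ε k Z) (hf : IsSubmodular f)
    (h0 : ∀ S, 0 ≤ f S) (hε : 0 ≤ ε) (hk : 1 ≤ k) (hZ : Z.card ≤ k) {T : Finset N}
    (hT : T.card ≤ k) : f (Z ∪ T) + f (Z ∩ T) ≤ 2 * (1 + ε) * f Z := by
  have hk' : (0 : ℝ) < k := by exact_mod_cast hk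
  have hδ : 0 ≤ ε / k * f Z := mul_nonneg (by positivity) (h0 Z)
  have hkδ : k * (ε / k * f Z) = ε * f Z := by field_simp
  have hU := hf.union_sub_le_sum Z (T \ Z)
  rw [Finset.union_sdiff_self_eq_union] at hU
  have hTZ : ((T \ Z).card : ℝ) * (ε / k * f Z) ≤ ε * f Z := by
    rw [← hkδ]
    have : (T \ Z).card ≤ k := (Finset.card_le_card Finset.sdiff_subset).trans hT
    exact mul_le_mul_of_nonneg_right (by exact_mod_cast this) hδ
  rcases hZ.lt_or_eq with hlt | heq
  · have h2 : ∑ u ∈ T \ Z, (f (insert u Z) - f Z) ≤ ∑ u ∈ T \ Z, ε / k * f Z := by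
      refine Finset.sum_le_sum fun u hu => ?_
      have := h.le h0 hε (T := insert u Z)
        (mem_localMoves.2 (Or.inl ⟨hlt, u, (Finset.mem_sdiff.1 hu).2, rfl⟩))
      linarith
    rw [Finset.sum_const, nsmul_eq_mul] at h2
    have h3 := h.inter_le hf h0 hε hk hZ T
    linarith
  · have hcard : (T \ Z).card ≤ (Z \ T).card := by
      have := Finset.card_sdiff_add_card_inter T Z
      have h2 := Finset.card_sdiff_add_card_inter Z T
      rw [Finset.inter_comm] at h2
      omega
    obtain ⟨D, hD, hDc⟩ := Finset.exists_subset_card_eq hcard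
    obtain ⟨e⟩ : Nonempty ((T \ Z : Finset N) ≃ D) :=
      Fintype.card_eq.1 (by rw [Fintype.card_coe, Fintype.card_coe, hDc])
    have hsum : ∑ v ∈ D, (f Z - f (Z.erase v)) =
        ∑ u : (T \ Z : Finset N), (f Z - f (Z.erase (e u))) := by
      rw [← Finset.sum_coe_sort]
      exact (Equiv.sum_comp e fun v => f Z - f (Z.erase v)).symm
    have h2 : ∑ u ∈ T \ Z, (f (insert u Z) - f Z) ≤
        (T \ Z).card * (ε / k * f Z) + ∑ v ∈ D, (f Z - f (Z.erase v)) := by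
      rw [hsum, ← Finset.sum_coe_sort]
      have : ((T \ Z).card : ℝ) * (ε / k * f Z) =
          ∑ u : (T \ Z : Finset N), ε / k * f Z := by simp
      rw [this, ← Finset.sum_add_distrib]
      refine Finset.sum_le_sum fun u _ => ?_
      have huZ : (u : N) ∉ Z := (Finset.mem_sdiff.1 u.2).2
      have hvZ : (e u : N) ∈ Z := (Finset.mem_sdiff.1 (hD (e u).2)).1
      have h3 := h.le h0 hε (T := insert (u : N) (Z.erase (e u)))
        (mem_localMoves.2 (Or.inr (Or.inl ⟨heq, u, huZ, e u, hvZ, rfl⟩)))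
      have h4 := hf (Z.erase (e u)) Z (Finset.erase_subset _ _) u huZ
      linarith
    -- The elements of `Z \ T` left unmatched.
    have h5 : ∑ v ∈ (Z \ T) \ D, (-(ε / k * f Z)) ≤
        ∑ v ∈ (Z \ T) \ D, (f Z - f (Z.erase v)) := by
      refine Finset.sum_le_sum fun v hv => ?_
      have := h.le h0 hε (T := Z.erase v) (mem_localMoves.2 (Or.inr (Or.inr
        ⟨v, (Finset.mem_sdiff.1 (Finset.mem_sdiff.1 hv).1).1, rfl⟩)))
      linarith
    have h6 : (((Z \ T) \ D).card : ℝ) * (ε / k * f Z) ≤ ε * f Z := by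
      rw [← hkδ]
      have : ((Z \ T) \ D).card ≤ k :=
        (Finset.card_le_card (Finset.sdiff_subset.trans Finset.sdiff_subset)).trans hZ
      exact mul_le_mul_of_nonneg_right (by exact_mod_cast this) hδ
    have h7 := hf.sum_erase_le Z (Z \ T) Finset.sdiff_subset
    rw [sdiff_sdiff_right_self, Finset.inf_eq_inter, ← Finset.sum_sdiff hD] at h7
    rw [Finset.sum_const, nsmul_eq_mul] at h5
    linarith

end LocalOpt

/-! ### A one-pass constant-factor approximation -/

section Stream

variable {N : Type} [DecidableEq N] {f : Finset N → ℝ} {k : ℕ}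

/-- One pass over a list of elements, building two disjoint sets. The sets are kept as lists
with the newest element first, and `a`, `b` are their values. An element goes to the set to which
it adds more, provided that it increases the value of that set by a factor of `1 + 1 / k`. -/
noncomputable def streamPass (k : ℕ) :
    List N → List N → List N → ℝ → ℝ → OracleAlg N (List N × List N)
  | [], A, B, _, _ => ret (A, B)
  | u :: us, A, B, a, b =>
    query (insert u A.toFinset) fun x => query (insert u B.toFinset) fun y =>
      if y - b ≤ x - a ∧ a ≤ k * (x - a) then streamPass k us (u :: A) B x b
      else if x - a ≤ y - b ∧ b ≤ k * (y - b) then streamPass k us A (u :: B) a y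
      else streamPass k us A B a b

/-- Each element of the list, when it was added to those behind it, increased the value by
a factor of `1 + 1 / k`. -/
def Grows (f : Finset N → ℝ) (k : ℕ) : List N → Prop
  | [] => True
  | u :: A => f A.toFinset ≤ k * (f (insert u A.toFinset) - f A.toFinset) ∧ Grows f k A

theorem Grows.pow_mul_le (hk : 1 ≤ k) {A : List N} (hA : Grows f k A) {j : ℕ}
    (hj : j ≤ A.length) :
    (1 + 1 / (k : ℝ)) ^ j * f (A.drop j).toFinset ≤ f A.toFinset := by
  induction A generalizing j with
  | nil =>
    obtain rfl : j = 0 := by simpa using hj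
    simp
  | cons u A ih =>
    cases j with
    | zero => simp
    | succ j =>
      have hk' : (0 : ℝ) < k := by exact_mod_cast hk
      have h1 := ih hA.2 (j := j) (by simpa using hj)
      have h2 : (1 + 1 / (k : ℝ)) * f A.toFinset ≤ f (insert u A.toFinset) := by
        have : 1 / (k : ℝ) * f A.toFinset ≤ f (insert u A.toFinset) - f A.toFinset := by
          rw [one_div, inv_mul_le_iff₀ hk']
          exact hA.1
        linarith
      rw [List.drop_succ_cons, List.toFinset_cons, pow_succ', mul_assoc]
      refine le_trans ?_ h2
      gcongr

/-- The last `k` elements of a list of growing value carry at least half of the value, because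
the value doubled while they were added. -/
theorem Grows.le_two_mul_take (hf : IsSubmodular f) (h0 : ∀ S, 0 ≤ f S) (hk : 1 ≤ k)
    {A : List N} (hA : Grows f k A) : f A.toFinset ≤ 2 * f (A.take k).toFinset := by
  rcases le_total A.length k with h | h
  · rw [List.take_of_length_le h]
    linarith [h0 A.toFinset]
  · have hk' : (k : ℝ) ≠ 0 := by positivity
    have h1 := hA.pow_mul_le hk h
    have h2 : (1 : ℝ) + k * (1 / k) ≤ (1 + 1 / k) ^ k :=
      one_add_mul_le_pow (by have : (0 : ℝ) ≤ 1 / k := by positivity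
                             linarith) k
    rw [mul_one_div_cancel hk'] at h2
    have h3 : (1 + 1) * f (A.drop k).toFinset ≤ f A.toFinset :=
      (mul_le_mul_of_nonneg_right h2 (h0 _)).trans h1
    have h4 := hf.union_le_add h0 (A.take k).toFinset (A.drop k).toFinset
    rw [← List.toFinset_append, List.take_append_drop] at h4
    linarith

/-- The state of `streamPass` after the elements of `P`. -/
structure StreamInv (f : Finset N → ℝ) (k : ℕ) (P : Finset N) (A B : List N) : Prop where
  grows_left : Grows f k A
  grows_right : Grows f k B
  subset_left : A.toFinset ⊆ P
  subset_right : B.toFinset ⊆ P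
  disjoint : Disjoint A.toFinset B.toFinset
  sum_left : ∑ o ∈ B.toFinset, max (f (insert o A.toFinset) - f A.toFinset) 0 ≤ f B.toFinset
  sum_right : ∑ o ∈ A.toFinset, max (f (insert o B.toFinset) - f B.toFinset) 0 ≤ f A.toFinset
  rejected : ∀ o ∈ P, o ∉ A.toFinset → o ∉ B.toFinset →
    k * max (f (insert o A.toFinset) - f A.toFinset) 0 ≤ f A.toFinset + f B.toFinset ∧
    k * max (f (insert o B.toFinset) - f B.toFinset) 0 ≤ f A.toFinset + f B.toFinset

theorem StreamInv.symm {P : Finset N} {A B : List N} (h : StreamInv f k P A B) :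
    StreamInv f k P B A where
  grows_left := h.grows_right
  grows_right := h.grows_left
  subset_left := h.subset_right
  subset_right := h.subset_left
  disjoint := h.disjoint.symm
  sum_left := h.sum_right
  sum_right := h.sum_left
  rejected o hP hB hA := by
    rw [add_comm]
    exact (h.rejected o hP hA hB).symm

theorem StreamInv.add_left (hf : IsSubmodular f) (h0 : ∀ S, 0 ≤ f S) (hk : 1 ≤ k)
    {P : Finset N} {A B : List N} (h : StreamInv f k P A B) {u : N} (hu : u ∉ P)
    (hle : f (insert u B.toFinset) - f B.toFinset ≤ f (insert u A.toFinset) - f A.toFinset)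
    (hgrow : f A.toFinset ≤ k * (f (insert u A.toFinset) - f A.toFinset)) :
    StreamInv f k (insert u P) (u :: A) B := by
  have hk' : (0 : ℝ) < k := by exact_mod_cast hk
  have hinc : 0 ≤ f (insert u A.toFinset) - f A.toFinset :=
    nonneg_of_mul_nonneg_right ((h0 _).trans hgrow) hk'
  have huA : u ∉ A.toFinset := fun h' => hu (h.subset_left h')
  have huB : u ∉ B.toFinset := fun h' => hu (h.subset_right h')
  have hgain : ∀ o, max (f (insert o (insert u A.toFinset)) - f (insert u A.toFinset)) 0 ≤
      max (f (insert o A.toFinset) - f A.toFinset) 0 := fun o =>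
    max_le (hf.gain_le_max (Finset.subset_insert _ _) o) (le_max_right _ _)
  refine ⟨⟨hgrow, h.grows_left⟩, h.grows_right, ?_, ?_, ?_, ?_, ?_, ?_⟩
  · rw [List.toFinset_cons]
    exact Finset.insert_subset_insert u h.subset_left
  · exact h.subset_right.trans (Finset.subset_insert _ _)
  · rw [List.toFinset_cons, Finset.disjoint_insert_left]
    exact ⟨huB, h.disjoint⟩
  · rw [List.toFinset_cons]
    exact (Finset.sum_le_sum fun o _ => hgain o).trans h.sum_left
  · rw [List.toFinset_cons, Finset.sum_insert huA]
    linarith [h.sum_right, max_le hle hinc]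
  · intro o hP hA hB
    rw [List.toFinset_cons, Finset.mem_insert, not_or] at hA
    obtain ⟨h1, h2⟩ := h.rejected o (Finset.mem_of_mem_insert_of_ne hP hA.1) hA.2 hB
    rw [List.toFinset_cons]
    have h3 := mul_le_mul_of_nonneg_left (hgain o) hk'.le
    exact ⟨by linarith, by linarith⟩

theorem StreamInv.reject (h0 : ∀ S, 0 ≤ f S) {P : Finset N} {A B : List N}
    (h : StreamInv f k P A B) {u : N}
    (hA : f (insert u B.toFinset) - f B.toFinset ≤ f (insert u A.toFinset) - f A.toFinset →
      k * (f (insert u A.toFinset) - f A.toFinset) < f A.toFinset)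
    (hB : f (insert u A.toFinset) - f A.toFinset ≤ f (insert u B.toFinset) - f B.toFinset →
      k * (f (insert u B.toFinset) - f B.toFinset) < f B.toFinset) :
    StreamInv f k (insert u P) A B := by
  refine ⟨h.grows_left, h.grows_right, h.subset_left.trans (Finset.subset_insert _ _),
    h.subset_right.trans (Finset.subset_insert _ _), h.disjoint, h.sum_left, h.sum_right, ?_⟩
  intro o hP hoA hoB
  rcases Finset.mem_insert.1 hP with rfl | hP
  · have hk' : (0 : ℝ) ≤ k := by positivity
    have := h0 A.toFinset
    have := h0 B.toFinset
    rw [mul_max_of_nonneg _ _ hk', mul_max_of_nonneg _ _ hk', mul_zero]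
    rcases le_total (f (insert o B.toFinset) - f B.toFinset)
      (f (insert o A.toFinset) - f A.toFinset) with hle | hle
    · have h1 := hA hle
      have h2 := mul_le_mul_of_nonneg_left hle hk'
      exact ⟨max_le (by linarith) (by linarith), max_le (by linarith) (by linarith)⟩
    · have h1 := hB hle
      have h2 := mul_le_mul_of_nonneg_left hle hk'
      exact ⟨max_le (by linarith) (by linarith), max_le (by linarith) (by linarith)⟩
  · exact h.rejected o hP hoA hoB

theorem streamPass_spec (hf : IsSubmodular f) (h0 : ∀ S, 0 ≤ f S) (hk : 1 ≤ k)
    {l : List N} (hl : l.Nodup) {P : Finset N} (hP : ∀ u ∈ l, u ∉ P) {A B : List N}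
    (h : StreamInv f k P A B) {r : (List N × List N) × ℕ}
    (hr : r ∈ (run f (streamPass k l A B (f A.toFinset) (f B.toFinset))).support) :
    r.2 = 2 * l.length ∧ StreamInv f k (P ∪ l.toFinset) r.1.1 r.1.2 := by
  induction l generalizing P A B r with
  | nil =>
    rw [streamPass, mem_support_run_ret] at hr
    subst hr
    simpa using h
  | cons u l ih =>
    rw [streamPass, mem_support_run_query] at hr
    obtain ⟨r', hr', rfl⟩ := hr
    rw [mem_support_run_query] at hr'
    obtain ⟨s, hs, rfl⟩ := hr'
    have hu : u ∉ P := hP u (by simp)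
    have hP' : ∀ v ∈ l, v ∉ insert u P := by
      intro v hv
      rw [Finset.mem_insert, not_or]
      exact ⟨fun e => (List.nodup_cons.1 hl).1 (e ▸ hv), hP v (by simp [hv])⟩
    suffices H : s.2 = 2 * l.length ∧ StreamInv f k (insert u P ∪ l.toFinset) s.1.1 s.1.2 by
      rw [List.toFinset_cons, Finset.union_insert, ← Finset.insert_union]
      refine ⟨?_, H.2⟩
      simp only [H.1, List.length_cons]
      ring
    split_ifs at hs with h1 h2
    · rw [← List.toFinset_cons] at hs
      exact ih hl.of_cons hP' (h.add_left hf h0 hk hu h1.1 h1.2) hs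
    · rw [← List.toFinset_cons] at hs
      exact ih hl.of_cons hP' (h.symm.add_left hf h0 hk hu h2.1 h2.2).symm hs
    · refine ih hl.of_cons hP' (h.reject h0 (fun hle => ?_) (fun hle => ?_)) hs
      · by_contra! hc
        exact h1 ⟨hle, hc⟩
      · by_contra! hc
        exact h2 ⟨hle, hc⟩

/-- An element of `T` outside `A` either lies in `B`, and these elements gain at most `f B` in
total, or was rejected, and then gains at most `(f A + f B) / k`. -/
theorem StreamInv.union_le (hf : IsSubmodular f) (h0 : ∀ S, 0 ≤ f S) (hk : 1 ≤ k)
    {P : Finset N} {A B : List N} (h : StreamInv f k P A B) {T : Finset N} (hTP : T ⊆ P)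
    (hT : T.card ≤ k) :
    f (A.toFinset ∪ T) ≤ 2 * (f A.toFinset + f B.toFinset) := by
  have hk' : (0 : ℝ) < k := by exact_mod_cast hk
  set g : N → ℝ := fun o => max (f (insert o A.toFinset) - f A.toFinset) 0 with hg
  have hg0 : ∀ o, 0 ≤ g o := fun o => le_max_right _ _
  have h1 := hf.union_sub_le_sum A.toFinset (T \ A.toFinset)
  rw [Finset.union_sdiff_self_eq_union] at h1
  have h2 : ∑ u ∈ T \ A.toFinset, (f (insert u A.toFinset) - f A.toFinset) ≤
      ∑ u ∈ T \ A.toFinset, g u := Finset.sum_le_sum fun o _ => le_max_left _ _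
  have h3 : ∑ u ∈ (T \ A.toFinset) ∩ B.toFinset, g u ≤ f B.toFinset :=
    (Finset.sum_le_sum_of_subset_of_nonneg Finset.inter_subset_right
      fun o _ _ => hg0 o).trans h.sum_left
  have h4 : ∑ u ∈ (T \ A.toFinset) \ B.toFinset, g u ≤ f A.toFinset + f B.toFinset := by
    have h5 : ∑ u ∈ (T \ A.toFinset) \ B.toFinset, g u ≤
        ∑ u ∈ (T \ A.toFinset) \ B.toFinset, (f A.toFinset + f B.toFinset) / k := by
      refine Finset.sum_le_sum fun o ho => ?_
      simp only [Finset.mem_sdiff] at ho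
      rw [le_div_iff₀' hk']
      exact (h.rejected o (hTP ho.1.1) ho.1.2 ho.2).1
    have h6 : ((T \ A.toFinset) \ B.toFinset).card ≤ k :=
      (Finset.card_le_card (Finset.sdiff_subset.trans Finset.sdiff_subset)).trans hT
    rw [Finset.sum_const, nsmul_eq_mul] at h5
    refine h5.trans ?_
    rw [mul_div_assoc', div_le_iff₀' hk']
    exact mul_le_mul_of_nonneg_right (by exact_mod_cast h6) (add_nonneg (h0 _) (h0 _))
  have h7 := Finset.sum_inter_add_sum_sdiff (T \ A.toFinset) B.toFinset g
  linarith

end Stream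

/-- The initial solution: the better of the sets of the last `k` elements of the two lists that
`streamPass` builds from the whole ground set. -/
noncomputable def streamInit {N : Type} [Fintype N] [LinearOrder N] (k : ℕ) :
    OracleAlg N (Finset N) :=
  query ∅ fun v =>
  bind (streamPass k (Finset.univ.sort (· ≤ ·)) [] [] v v) fun p =>
  query (p.1.take k).toFinset fun x =>
  query (p.2.take k).toFinset fun y =>
  ret (if y ≤ x then (p.1.take k).toFinset else (p.2.take k).toFinset)

theorem card_toFinset_take_le {N : Type} [DecidableEq N] (k : ℕ) (l : List N) :
    (l.take k).toFinset.card ≤ k :=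
  (List.toFinset_card_le _).trans (List.length_take_le k l)

theorem streamInit_spec {N : Type} [Fintype N] [LinearOrder N] {f : Finset N → ℝ}
    (hf : IsSubmodular f) (h0 : ∀ S, 0 ≤ f S) {k : ℕ} (hk : 1 ≤ k) {r : Finset N × ℕ}
    (hr : r ∈ (run f (streamInit k)).support) :
    r.2 = 2 * Fintype.card N + 3 ∧ r.1.card ≤ k ∧
      ∀ T : Finset N, T.card ≤ k → 1 / 16 * f T ≤ f r.1 := by
  rw [streamInit, mem_support_run_query] at hr
  obtain ⟨r', hr', rfl⟩ := hr
  rw [mem_support_run_bind] at hr'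
  obtain ⟨⟨⟨A, B⟩, c⟩, hs, t, ht, rfl⟩ := hr'
  simp only [mem_support_run_query, mem_support_run_ret] at ht
  obtain ⟨_, ⟨_, rfl, rfl⟩, rfl⟩ := ht
  have hinit : StreamInv f k ∅ [] [] :=
    ⟨trivial, trivial, by simp, by simp, by simp, by simpa using h0 ∅, by simpa using h0 ∅,
      by simp⟩
  obtain ⟨hc, hinv⟩ := streamPass_spec hf h0 hk (Finset.sort_nodup Finset.univ _)
    (by simp) hinit hs
  dsimp only at hc hinv ⊢
  refine ⟨?_, ?_, fun T hT => ?_⟩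
  · rw [hc, Finset.length_sort, Finset.card_univ]
  · split_ifs <;> exact card_toFinset_take_le k _
  · have hTP : T ⊆ ∅ ∪ (Finset.univ.sort (· ≤ ·) : List N).toFinset := by
      intro x _
      simp
    have h1 := hinv.union_le hf h0 hk hTP hT
    have h2 := hinv.symm.union_le hf h0 hk hTP hT
    have h3 := hf.union_add_inter_le (A.toFinset ∪ T) (B.toFinset ∪ T)
    rw [← Finset.inter_union_distrib_right, Finset.disjoint_iff_inter_eq_empty.1 hinv.disjoint,
      Finset.empty_union] at h3
    have h4 := h0 (A.toFinset ∪ T ∪ (B.toFinset ∪ T))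
    have h5 := hinv.grows_left.le_two_mul_take hf h0 hk
    have h6 := hinv.grows_right.le_two_mul_take hf h0 hk
    split_ifs with h7 <;> linarith

/-! ### Guided Random Greedy -/

theorem bestSubset_subset {N : Type} (k : ℕ) (V : Finset N) (w : N → ℝ) :
    bestSubset k V w ⊆ V :=
  (Classical.choose_spec (exists_bestSubset k V w)).1.1

theorem card_bestSubset_le {N : Type} (k : ℕ) (V : Finset N) (w : N → ℝ) :
    (bestSubset k V w).card ≤ k :=
  (Classical.choose_spec (exists_bestSubset k V w)).1.2

theorem sum_le_sum_bestSubset {N : Type} {k : ℕ} {V : Finset N} (w : N → ℝ) {M : Finset N}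
    (hM : M ⊆ V) (hk : M.card ≤ k) : ∑ u ∈ M, w u ≤ ∑ u ∈ bestSubset k V w, w u :=
  (Classical.choose_spec (exists_bestSubset k V w)).2 M hM hk

theorem askGains_spec {N : Type} [DecidableEq N] (f : Finset N → ℝ) (S : Finset N) (v : ℝ)
    (l : List N) {r : (N → ℝ) × ℕ} (hr : r ∈ (run f (askGains S v l)).support) :
    r.2 = l.length ∧ ∀ u ∈ l, r.1 u = f (insert u S) - v := by
  induction l generalizing r with
  | nil =>
    rw [askGains, mem_support_run_ret] at hr
    subst hr
    simp
  | cons u l ih =>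
    rw [askGains, mem_support_run_query] at hr
    obtain ⟨r', hr', rfl⟩ := hr
    rw [mem_support_run_bind] at hr'
    obtain ⟨s, hs, t, ht, rfl⟩ := hr'
    rw [mem_support_run_ret] at ht
    subst ht
    obtain ⟨h1, h2⟩ := ih hs
    refine ⟨by simp [h1], fun x hx => ?_⟩
    by_cases hxu : x = u
    · subst hxu; simp
    · simpa [hxu] using h2 x ((List.mem_cons.1 hx).resolve_left hxu)

theorem sum_range_getElem?_elim {α : Type} (g : α → ℝ) (l : List α) {m : ℕ}
    (hm : l.length ≤ m) : ∑ i ∈ Finset.range m, (l[i]?).elim 0 g = (l.map g).sum := by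
  induction l generalizing m with
  | nil => simp
  | cons a l ih =>
    obtain ⟨m, rfl⟩ : ∃ m', m = m' + 1 := ⟨m - 1, by simp at hm; omega⟩
    rw [Finset.sum_range_succ']
    simp only [List.getElem?_cons_succ, List.getElem?_cons_zero, Option.elim_some,
      List.map_cons, List.sum_cons]
    rw [ih (by simpa using hm), add_comm]

section Greedy

variable {N : Type} [LinearOrder N] {f : Finset N → ℝ} {k : ℕ}

theorem greedyStep_spec {V S : Finset N} {r : Finset N × ℕ}
    (hr : r ∈ (run f (greedyStep k V S)).support) :
    r.2 = V.card + 1 ∧ (r.1 = S ∨ ∃ u ∈ V, r.1 = insert u S) := by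
  rw [greedyStep, mem_support_run_query] at hr
  obtain ⟨r', hr', rfl⟩ := hr
  rw [mem_support_run_bind] at hr'
  obtain ⟨s, hs, t, ht, rfl⟩ := hr'
  have h1 := (askGains_spec f S _ _ hs).1
  rw [Finset.length_sort] at h1
  rw [mem_support_run_uniform] at ht
  obtain ⟨i, hi⟩ := ht
  cases hl : ((bestSubset k V s.1).sort (· ≤ ·))[i.val]? with
  | none =>
    rw [hl] at hi
    rw [mem_support_run_ret] at hi
    subst hi
    exact ⟨by simp [h1], Or.inl rfl⟩
  | some u =>
    rw [hl] at hi
    rw [mem_support_run_ret] at hi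
    subst hi
    have hu := List.mem_of_getElem? hl
    rw [Finset.mem_sort] at hu
    exact ⟨by simp [h1], Or.inr ⟨u, bestSubset_subset k V _ hu, rfl⟩⟩

/-- The expectation after one greedy step is `φ S` plus `1 / k` times the sum of the increments of
`φ` over a set of at most `k` candidates with the largest sum of marginal gains. -/
theorem le_mean_greedyStep (hk : 1 ≤ k) {V S : Finset N} {φ : Finset N → ℝ} {c : ℝ}
    (h : ∀ M ⊆ V, M.card ≤ k →
      (∀ D ⊆ V, D.card ≤ k →
        ∑ u ∈ D, (f (insert u S) - f S) ≤ ∑ u ∈ M, (f (insert u S) - f S)) →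
      c ≤ φ S + (∑ u ∈ M, (φ (insert u S) - φ S)) / k) :
    c ≤ mean f (greedyStep k V S) φ := by
  obtain ⟨m, rfl⟩ : ∃ m, k = m + 1 := ⟨k - 1, by omega⟩
  rw [greedyStep, mean, mean_bind]
  refine le_mean fun r hr => ?_
  obtain ⟨-, hw⟩ := askGains_spec f S _ _ hr
  set M := bestSubset (m + 1) V r.1 with hM
  have hMV : M ⊆ V := bestSubset_subset _ _ _
  have hMk : M.card ≤ m + 1 := card_bestSubset_le _ _ _
  have hsum : ∀ D ⊆ V, ∑ u ∈ D, (f (insert u S) - f S) = ∑ u ∈ D, r.1 u := fun D hD =>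
    Finset.sum_congr rfl fun u hu => (hw u ((Finset.mem_sort _).2 (hD hu))).symm
  refine (h M hMV hMk fun D hD hDk => ?_).trans_eq ?_
  · rw [hsum D hD, hsum M hMV]
    exact sum_le_sum_bestSubset r.1 hD hDk
  · have hcase : ∀ o : Option N,
        mean f (match o with
          | none => ret S
          | some u => ret (insert u S)) φ = φ S + o.elim 0 fun u => φ (insert u S) - φ S := by
      intro o
      cases o <;> simp [mean]
    simp only [Nat.add_sub_cancel, mean]
    refine Eq.trans ?_ (congrArg (· / ((m : ℝ) + 1)) (Finset.sum_congr rfl fun i _ =>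
      (hcase ((M.sort (· ≤ ·))[i.val]?)).symm))
    simp only [Finset.sum_add_distrib, Finset.sum_const, Finset.card_univ, Fintype.card_fin,
      nsmul_eq_mul]
    rw [Fin.sum_univ_eq_sum_range (fun i => ((M.sort (· ≤ ·))[i]?).elim 0
        fun u => φ (insert u S) - φ S) (m + 1 - 1 + 1), Nat.add_sub_cancel,
      sum_range_getElem?_elim _ _ (by rw [Finset.length_sort]; exact hMk),
      ← List.sum_toFinset _ (Finset.sort_nodup M _), Finset.sort_toFinset]
    push_cast
    field_simp

/-- A greedy step retains a `1 - 1 / k` fraction of the value of the union with a fixed set, since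
the candidates together lose at most this value. -/
theorem mul_union_le_mean_greedyStep (hf : IsSubmodular f) (h0 : ∀ S, 0 ≤ f S) (hk : 1 ≤ k)
    (V S X : Finset N) :
    (1 - 1 / (k : ℝ)) * f (S ∪ X) ≤ mean f (greedyStep k V S) fun A => f (A ∪ X) := by
  refine le_mean_greedyStep hk fun M _ _ _ => ?_
  have hk' : (0 : ℝ) < k := by exact_mod_cast hk
  have h1 := hf.union_sub_le_sum (S ∪ X) M
  have h2 : -f (S ∪ X) / k ≤ (∑ u ∈ M, (f (insert u (S ∪ X)) - f (S ∪ X))) / k := by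
    gcongr
    linarith [h0 (S ∪ X ∪ M)]
  simp only [Finset.insert_union]
  calc (1 - 1 / (k : ℝ)) * f (S ∪ X) = f (S ∪ X) + -f (S ∪ X) / k := by ring
    _ ≤ _ := by gcongr

/-- The expected gain of a greedy step is at least a `1 / k` fraction of the gain of any
feasible set whose new elements are available. -/
theorem gain_le_mean_greedyStep (hf : IsSubmodular f) (hk : 1 ≤ k) {V S D : Finset N}
    (hD : D \ S ⊆ V) (hDk : D.card ≤ k) :
    (1 - 1 / (k : ℝ)) * f S + 1 / k * f (S ∪ D) ≤ mean f (greedyStep k V S) f := by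
  refine le_mean_greedyStep hk fun M _ _ hM => ?_
  have hk' : (0 : ℝ) < k := by exact_mod_cast hk
  have h1 := hf.union_sub_le_sum S (D \ S)
  rw [Finset.union_sdiff_self_eq_union] at h1
  have h2 := hM (D \ S) hD ((Finset.card_le_card Finset.sdiff_subset).trans hDk)
  calc (1 - 1 / (k : ℝ)) * f S + 1 / k * f (S ∪ D) = f S + (f (S ∪ D) - f S) / k := by ring
    _ ≤ _ := by
      gcongr
      exact h1.trans h2

end Greedy

section Guided

variable {N : Type} [Fintype N] [LinearOrder N] {f : Finset N → ℝ} {k : ℕ} {ts : ℝ}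
  {Z : Finset N}

theorem guidedSteps_spec {i : ℕ} {r : Finset N × ℕ}
    (hr : r ∈ (run f (guidedSteps k ts Z i)).support) :
    r.1.card ≤ i ∧ r.2 ≤ i * (Fintype.card N + 1) ∧
      (i ≤ ⌈(k : ℝ) * ts⌉₊ → Disjoint r.1 Z) := by
  induction i generalizing r with
  | zero =>
    rw [guidedSteps, mem_support_run_ret] at hr
    subst hr
    simp
  | succ i ih =>
    rw [guidedSteps, mem_support_run_bind] at hr
    obtain ⟨s, hs, t, ht, rfl⟩ := hr
    obtain ⟨h1, h2, h3⟩ := ih hs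
    obtain ⟨h4, h5⟩ := greedyStep_spec ht
    refine ⟨?_, ?_, fun hi => ?_⟩
    · rcases h5 with h5 | ⟨u, -, h5⟩
      · rw [h5]; omega
      · rw [h5]
        exact (Finset.card_insert_le u s.1).trans (by omega)
    · have h6 : ∀ W : Finset N, W.card ≤ Fintype.card N := fun W => Finset.card_le_univ W
      rw [h4, Nat.succ_mul]
      exact Nat.add_le_add h2 (Nat.succ_le_succ (h6 _))
    · have h3' := h3 (by omega)
      rcases h5 with h5 | ⟨u, hu, h5⟩
      · rwa [h5]
      · rw [if_pos hi, Finset.mem_compl, Finset.mem_union, not_or] at hu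
        rw [h5, Finset.disjoint_insert_left]
        exact ⟨hu.2, h3'⟩

theorem mul_mean_union_le_mean_guidedSteps_succ (hf : IsSubmodular f) (h0 : ∀ S, 0 ≤ f S)
    (hk : 1 ≤ k) (X : Finset N) (i : ℕ) :
    (1 - 1 / (k : ℝ)) * mean f (guidedSteps k ts Z i) (fun A => f (A ∪ X)) ≤
      mean f (guidedSteps k ts Z (i + 1)) fun A => f (A ∪ X) := by
  rw [guidedSteps, mean_bind, ← mean_const_mul]
  exact mean_mono fun r _ => mul_union_le_mean_greedyStep hf h0 hk _ _ _

theorem one_sub_one_div_nonneg (hk : 1 ≤ k) : (0 : ℝ) ≤ 1 - 1 / k := by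
  have : (1 : ℝ) ≤ k := by exact_mod_cast hk
  rw [sub_nonneg]
  exact div_le_one_of_le₀ this (by positivity)

theorem pow_mul_mean_union_le_mean_guidedSteps_add (hf : IsSubmodular f) (h0 : ∀ S, 0 ≤ f S)
    (hk : 1 ≤ k) (X : Finset N) (i j : ℕ) :
    (1 - 1 / (k : ℝ)) ^ j * mean f (guidedSteps k ts Z i) (fun A => f (A ∪ X)) ≤
      mean f (guidedSteps k ts Z (i + j)) fun A => f (A ∪ X) := by
  induction j with
  | zero => simp
  | succ j ih =>
    rw [← add_assoc, pow_succ', mul_assoc]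
    exact (mul_le_mul_of_nonneg_left ih (one_sub_one_div_nonneg hk)).trans
      (mul_mean_union_le_mean_guidedSteps_succ hf h0 hk X (i + j))

/-- As the current set `A` avoids `Z`, submodularity bounds the loss from `f X` to `f (A ∪ X)` by
the loss from `f W` to `f (A ∪ W)`, and in expectation the latter is at most a fraction
`1 - (1 - 1 / k) ^ i` of `f W`. -/
theorem sub_le_mean_union_guidedSteps (hf : IsSubmodular f) (h0 : ∀ S, 0 ≤ f S) (hk : 1 ≤ k)
    {X W : Finset N} (hXW : X ⊆ W) (hWZ : W ⊆ X ∪ Z) {i : ℕ} (hi : i ≤ ⌈(k : ℝ) * ts⌉₊) :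
    f X - (1 - (1 - 1 / (k : ℝ)) ^ i) * f W ≤
      mean f (guidedSteps k ts Z i) fun A => f (A ∪ X) := by
  have h1 := pow_mul_mean_union_le_mean_guidedSteps_add (ts := ts) (Z := Z) hf h0 hk W 0 i
  rw [zero_add, guidedSteps, mean, Finset.empty_union] at h1
  have h2 : mean f (guidedSteps k ts Z i) (fun A => f (A ∪ W) + (f X - f W)) ≤
      mean f (guidedSteps k ts Z i) fun A => f (A ∪ X) := by
    refine mean_mono fun r hr => ?_
    have hdisj := (guidedSteps_spec hr).2.2 hi
    have h3 := hf.union_add_inter_le (r.1 ∪ X) W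
    have e1 : r.1 ∪ X ∪ W = r.1 ∪ W := by
      rw [Finset.union_assoc, Finset.union_eq_right.2 hXW]
    have e2 : (r.1 ∪ X) ∩ W = X := by
      ext x
      simp only [Finset.mem_inter, Finset.mem_union]
      constructor
      · rintro ⟨hx | hx, hxW⟩
        · exact (Finset.mem_union.1 (hWZ hxW)).resolve_right
            fun hZ => Finset.disjoint_left.1 hdisj hx hZ
        · exact hx
      · exact fun hx => ⟨Or.inr hx, hXW hx⟩
    rw [e1, e2] at h3
    linarith
  rw [mean_add, mean_const] at h2
  linarith

/-- Expected value of the greedy solution while the guiding set is avoided. -/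
theorem le_mean_guidedSteps (hf : IsSubmodular f) (h0 : ∀ S, 0 ≤ f S) (hk : 1 ≤ k)
    {T : Finset N} (hT : T.card ≤ k) {i : ℕ} (hi : i ≤ ⌈(k : ℝ) * ts⌉₊) :
    (1 - (1 - 1 / (k : ℝ)) ^ i) * (f (T \ Z) - f (T ∪ Z)) +
        i / k * (1 - 1 / (k : ℝ)) ^ (i - 1) * f (T ∪ Z) ≤
      mean f (guidedSteps k ts Z i) f := by
  induction i with
  | zero => simpa [guidedSteps, mean] using h0 ∅
  | succ i ih =>
    have hq := one_sub_one_div_nonneg hk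
    have h1 : (1 - 1 / (k : ℝ)) * mean f (guidedSteps k ts Z i) f +
        1 / k * mean f (guidedSteps k ts Z i) (fun A => f (A ∪ (T \ Z))) ≤
        mean f (guidedSteps k ts Z (i + 1)) f := by
      rw [guidedSteps, mean_bind, ← mean_const_mul, ← mean_const_mul, ← mean_add]
      refine mean_mono fun r _ => ?_
      rw [if_pos hi]
      refine gain_le_mean_greedyStep hf hk ?_
        ((Finset.card_le_card Finset.sdiff_subset).trans hT)
      intro x
      simp only [Finset.mem_sdiff, Finset.mem_compl, Finset.mem_union]
      tauto
    have h2 := sub_le_mean_union_guidedSteps (ts := ts) (Z := Z) hf h0 hk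
      (X := T \ Z) (W := T ∪ Z) (Finset.sdiff_subset.trans Finset.subset_union_left)
      (by rw [Finset.sdiff_union_self_eq_union]) (i := i) (by omega)
    have h3 := mul_le_mul_of_nonneg_left (ih (by omega)) hq
    have h4 := mul_le_mul_of_nonneg_left h2 (show (0 : ℝ) ≤ 1 / k by positivity)
    have h5 : (1 - 1 / (k : ℝ)) * (i / k * (1 - 1 / (k : ℝ)) ^ (i - 1)) =
        i / k * (1 - 1 / (k : ℝ)) ^ i := by
      cases i with
      | zero => simp
      | succ i => rw [Nat.add_sub_cancel, pow_succ]; ring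
    rw [Nat.add_sub_cancel]
    push_cast
    set q := 1 - 1 / (k : ℝ) with hqdef
    have h6 : 1 / (k : ℝ) = 1 - q := by rw [hqdef]; ring
    have h7 : ((i : ℝ) + 1) / k = i / k + (1 - q) := by rw [← h6]; ring
    rw [h7]
    rw [h6] at h1 h4
    refine le_trans (le_of_eq ?_) ((add_le_add h3 h4).trans h1)
    rw [mul_add, ← mul_assoc q (_ / _ * _), h5]
    ring

/-- Expected value of the greedy solution after the guiding set is released. -/
theorem le_mean_guidedSteps_add (hf : IsSubmodular f) (h0 : ∀ S, 0 ≤ f S) (hk : 1 ≤ k)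
    {T : Finset N} (hT : T.card ≤ k) {s : ℕ} (hs : s = ⌈(k : ℝ) * ts⌉₊) (j : ℕ) :
    (1 - 1 / (k : ℝ)) ^ j * mean f (guidedSteps k ts Z s) f +
        j / k * (1 - 1 / (k : ℝ)) ^ (j - 1) *
          (f T - (1 - (1 - 1 / (k : ℝ)) ^ s) * f (T ∪ Z)) ≤
      mean f (guidedSteps k ts Z (s + j)) f := by
  induction j with
  | zero => simp
  | succ j ih =>
    have hq := one_sub_one_div_nonneg hk
    have h1 : (1 - 1 / (k : ℝ)) * mean f (guidedSteps k ts Z (s + j)) f +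
        1 / k * mean f (guidedSteps k ts Z (s + j)) (fun A => f (A ∪ T)) ≤
        mean f (guidedSteps k ts Z (s + j + 1)) f := by
      rw [guidedSteps, mean_bind, ← mean_const_mul, ← mean_const_mul, ← mean_add]
      refine mean_mono fun r _ => ?_
      rw [if_neg (by omega)]
      refine gain_le_mean_greedyStep hf hk ?_ hT
      intro x
      simp only [Finset.mem_sdiff, Finset.mem_compl]
      tauto
    have h2 := sub_le_mean_union_guidedSteps (ts := ts) (Z := Z) hf h0 hk
      (X := T) (W := T ∪ Z) Finset.subset_union_left Finset.Subset.rfl (i := s) hs.le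
    have h2' := pow_mul_mean_union_le_mean_guidedSteps_add (ts := ts) (Z := Z) hf h0 hk T s j
    have h3 := mul_le_mul_of_nonneg_left ih hq
    have h4 := mul_le_mul_of_nonneg_left
      ((mul_le_mul_of_nonneg_left h2 (pow_nonneg hq j)).trans h2')
      (show (0 : ℝ) ≤ 1 / k by positivity)
    have h5 : (1 - 1 / (k : ℝ)) * (j / k * (1 - 1 / (k : ℝ)) ^ (j - 1)) =
        j / k * (1 - 1 / (k : ℝ)) ^ j := by
      cases j with
      | zero => simp
      | succ j => rw [Nat.add_sub_cancel, pow_succ]; ring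
    rw [Nat.add_sub_cancel, ← add_assoc]
    push_cast
    refine le_trans (le_of_eq ?_) ((add_le_add h3 h4).trans h1)
    rw [mul_add, ← mul_assoc _ (_ / _ * _), h5]
    ring

end Guided

/-! ### The numerical inequality -/

section Numeric

theorem one_sub_one_div_pow_le_exp {k : ℕ} (hk : 1 ≤ k) (s : ℕ) :
    (1 - 1 / (k : ℝ)) ^ s ≤ Real.exp (-(s / k)) := by
  calc (1 - 1 / (k : ℝ)) ^ s ≤ Real.exp (-(1 / k)) ^ s :=
        pow_le_pow_left₀ (one_sub_one_div_nonneg hk) (Real.one_sub_le_exp_neg _) s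
    _ = _ := by rw [← Real.exp_nat_mul]; congr 1; ring

theorem exp_neg_one_le_one_sub_one_div_pow {k : ℕ} (hk : 2 ≤ k) :
    Real.exp (-1) ≤ (1 - 1 / (k : ℝ)) ^ (k - 1) := by
  obtain ⟨m, rfl⟩ : ∃ m, k = m + 1 := ⟨k - 1, by omega⟩
  have hm : (0 : ℝ) < m := by exact_mod_cast (by omega : 0 < m)
  have h1 : (1 + 1 / (m : ℝ)) ^ m ≤ Real.exp 1 := by
    calc (1 + 1 / (m : ℝ)) ^ m ≤ Real.exp (1 / m) ^ m :=
          pow_le_pow_left₀ (by positivity) (by linarith [Real.add_one_le_exp (1 / (m : ℝ))]) m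
      _ = Real.exp 1 := by
          rw [← Real.exp_nat_mul]; congr 1; field_simp
  have h2 : 1 - 1 / ((m + 1 : ℕ) : ℝ) = (1 + 1 / (m : ℝ))⁻¹ := by
    push_cast
    field_simp
    ring
  rw [h2, Nat.add_sub_cancel, inv_pow, Real.exp_neg]
  exact inv_anti₀ (by positivity) h1

/-- The numerical inequality for small `k`, by evaluation. -/
theorem ratio_le_of_lt_hundred {k : ℕ} (hk : 2 ≤ k) (hk' : k < 100) :
    (3851 / 10000 : ℝ) ≤ (1 - 1 / (k : ℝ)) ^ (k - (3 * k + 7) / 8 - 1) *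
      ((1 - 1 / (k : ℝ)) * (1 - (1 - 1 / (k : ℝ)) ^ ((3 * k + 7) / 8)) *
          (1 - 2 * (3851 / 10000)) +
        (1 - ((3 * k + 7) / 8 : ℕ) / k) *
          (1 - 3851 / 10000 * (1 - (1 - 1 / (k : ℝ)) ^ ((3 * k + 7) / 8))) +
        3851 / 10000 * (((3 * k + 7) / 8 : ℕ) / k) *
          (1 - 1 / (k : ℝ)) ^ ((3 * k + 7) / 8)) := by
  interval_cases k <;> norm_num

/-- The numerical inequality for large `k`, near its limit for `k → ∞`. Here `t` stands for
`(1 - 1 / k) ^ (-s)` and `a` for `s / k`. -/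
theorem ratio_mul_exp_one_le {q a t : ℝ} (hq : 99 / 100 ≤ q) (ha : 3 / 8 ≤ a)
    (ha' : a ≤ 3 / 8 + 7 / 800) (ht : Real.exp a ≤ t) :
    3851 / 10000 * Real.exp 1 ≤ q * (t - 1) * (1 - 2 * (3851 / 10000)) +
      (1 - a) * ((1 - 3851 / 10000) * t + 3851 / 10000) + 3851 / 10000 * a := by
  have he := Real.exp_one_lt_d9
  have h0 : (1.4549 : ℝ) ≤ Real.exp (3 / 8) := by
    refine le_trans ?_ (Real.sum_le_exp_of_nonneg (by norm_num : (0 : ℝ) ≤ 3 / 8) 7)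
    norm_num [Finset.sum_range_succ, Nat.factorial]
  have h1 : 1.4549 * (1 + (a - 3 / 8)) ≤ t := by
    refine le_trans ?_ ht
    have e : Real.exp a = Real.exp (3 / 8) * Real.exp (a - 3 / 8) := by
      rw [← Real.exp_add]; congr 1; ring
    rw [e]
    have h2 := Real.add_one_le_exp (a - 3 / 8)
    exact mul_le_mul h0 (by linarith) (by linarith) (Real.exp_nonneg _)
  obtain ⟨b, rfl⟩ : ∃ b, a = 3 / 8 + b := ⟨a - 3 / 8, by ring⟩
  have hb0 : 0 ≤ b := by linarith
  have hb1 : b ≤ 7 / 800 := by linarith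
  rw [add_sub_cancel_left] at h1
  have h3 : 99 / 100 * (1.4549 * (1 + b) - 1) ≤ q * (t - 1) :=
    mul_le_mul hq (by linarith) (by linarith) (by linarith)
  have h4 : (1 - (3 / 8 + b)) * ((1 - 3851 / 10000) * (1.4549 * (1 + b)) + 3851 / 10000) ≤
      (1 - (3 / 8 + b)) * ((1 - 3851 / 10000) * t + 3851 / 10000) :=
    mul_le_mul_of_nonneg_left (by linarith) (by linarith)
  nlinarith [mul_nonneg hb0 (sub_nonneg.2 hb1)]

/-- If the bound on the expected value of the greedy solution is `c O - l L - u U`, this is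
the inequality `R ≤ c - R (l + u)` with `R = 0.3851`, for the flip point `3 / 8`. -/
theorem ratio_le {k s : ℕ} (hk : 2 ≤ k) (hs : s = (3 * k + 7) / 8) :
    (3851 / 10000 : ℝ) ≤ (1 - 1 / (k : ℝ)) ^ (k - s - 1) *
      ((1 - 1 / (k : ℝ)) * (1 - (1 - 1 / (k : ℝ)) ^ s) * (1 - 2 * (3851 / 10000)) +
        (1 - s / k) * (1 - 3851 / 10000 * (1 - (1 - 1 / (k : ℝ)) ^ s)) +
        3851 / 10000 * (s / k) * (1 - 1 / (k : ℝ)) ^ s) := by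
  rcases lt_or_ge k 100 with h | h
  · subst hs
    exact ratio_le_of_lt_hundred hk h
  · have hk' : (100 : ℝ) ≤ k := by exact_mod_cast h
    have hq : (99 / 100 : ℝ) ≤ 1 - 1 / k := by
      have : 1 / (k : ℝ) ≤ 1 / 100 := by gcongr
      linarith
    have ha : (3 / 8 : ℝ) ≤ s / k := by
      rw [le_div_iff₀ (by linarith)]
      have : (3 * k : ℝ) ≤ 8 * s := by exact_mod_cast (by omega : 3 * k ≤ 8 * s)
      linarith
    have ha' : (s / k : ℝ) ≤ 3 / 8 + 7 / 800 := by
      rw [div_le_iff₀ (by linarith)]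
      have : (8 * s : ℝ) ≤ 3 * k + 7 := by exact_mod_cast (by omega : 8 * s ≤ 3 * k + 7)
      linarith
    have hE := exp_neg_one_le_one_sub_one_div_pow hk
    have hx := one_sub_one_div_pow_le_exp (by omega : 1 ≤ k) s
    have hkk : k - 1 = (k - s - 1) + s := by omega
    rw [hkk, pow_add] at hE
    set q := 1 - 1 / (k : ℝ) with hqdef
    have hx0 : 0 < q ^ s := pow_pos (by linarith) s
    set x := q ^ s
    set y := q ^ (k - s - 1)
    set a := (s / k : ℝ)
    have ht : Real.exp a ≤ x⁻¹ := by
      rw [Real.exp_neg] at hx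
      exact (le_inv_comm₀ hx0 (Real.exp_pos a)).1 hx
    have hB := ratio_mul_exp_one_le hq ha ha' ht
    set B := q * (x⁻¹ - 1) * (1 - 2 * (3851 / 10000)) +
      (1 - a) * ((1 - 3851 / 10000) * x⁻¹ + 3851 / 10000) + 3851 / 10000 * a with hBdef
    have h2 : Real.exp (-1) * (3851 / 10000 * Real.exp 1) = 3851 / 10000 := by
      rw [mul_left_comm, ← Real.exp_add]; simp
    calc (3851 / 10000 : ℝ) = Real.exp (-1) * (3851 / 10000 * Real.exp 1) := h2.symm
      _ ≤ y * x * B :=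
          mul_le_mul hE hB (by positivity) ((Real.exp_nonneg _).trans hE)
      _ = _ := by
          rw [hBdef]
          field_simp
          ring

end Numeric

/-! ### The approximation ratio -/

section Ratio

variable {N : Type} [Fintype N] [LinearOrder N] {f : Finset N → ℝ} {k : ℕ} {Z T : Finset N}

theorem ceil_mul_three_eighths (k : ℕ) : ⌈(k : ℝ) * (3 / 8)⌉₊ = (3 * k + 7) / 8 := by
  refine le_antisymm (Nat.ceil_le.2 ?_) ?_
  · have : (3 * k : ℝ) ≤ 8 * ((3 * k + 7) / 8 : ℕ) := by
      exact_mod_cast (by omega : 3 * k ≤ 8 * ((3 * k + 7) / 8))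
    linarith
  · have h1 := Nat.le_ceil ((k : ℝ) * (3 / 8))
    have : 3 * k ≤ 8 * ⌈(k : ℝ) * (3 / 8)⌉₊ := by
      have : (3 * k : ℝ) ≤ 8 * ⌈(k : ℝ) * (3 / 8)⌉₊ := by linarith
      exact_mod_cast this
    omega

/-- If `f (T ∩ Z)` and the average of `f (T ∩ Z)` and `f (T ∪ Z)` are at most `w`, a small `w`
makes the greedy solution good. -/
theorem ratio_mul_le_mean_guidedRandomGreedy (hf : IsSubmodular f) (h0 : ∀ S, 0 ≤ f S)
    (hk : 2 ≤ k) (hT : T.card ≤ k) {w : ℝ} (hL : f (T ∩ Z) ≤ w)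
    (hU : f (T ∪ Z) + f (T ∩ Z) ≤ 2 * w) (hw : w ≤ 3851 / 10000 * f T) :
    3851 / 10000 * f T ≤ mean f (guidedRandomGreedy k (3 / 8) Z) f := by
  obtain ⟨s, hs⟩ : ∃ s, s = (3 * k + 7) / 8 := ⟨_, rfl⟩
  have hceil : s = ⌈(k : ℝ) * (3 / 8)⌉₊ := by rw [ceil_mul_three_eighths, hs]
  have hk1 : 1 ≤ k := by omega
  have hk0 : (0 : ℝ) < k := by exact_mod_cast hk1
  have hsk : s + 1 ≤ k := by omega
  have h1 := le_mean_guidedSteps (Z := Z) hf h0 hk1 hT hceil.le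
  have h2 := le_mean_guidedSteps_add (Z := Z) hf h0 hk1 hT hceil (k - s)
  rw [Nat.add_sub_cancel' (by omega : s ≤ k), Nat.cast_sub (by omega : s ≤ k), sub_div,
    div_self hk0.ne'] at h2
  have hnum := ratio_le hk hs
  have hD : f T ≤ f (T \ Z) + f (T ∩ Z) := by
    have := hf.union_le_add h0 (T \ Z) (T ∩ Z)
    rwa [Finset.sdiff_union_inter] at this
  have hq0 := one_sub_one_div_nonneg hk1
  have hb : 1 - (s : ℝ) / k ≤ (1 - 1 / (k : ℝ)) ^ s := by
    have := one_add_mul_le_pow (a := -(1 / (k : ℝ))) (by linarith) s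
    rw [← sub_eq_add_neg] at this
    refine le_trans (le_of_eq ?_) this
    ring
  have hx : (1 - 1 / (k : ℝ)) ^ s * (1 + s / k) ≤ 1 := by
    have h3 := one_sub_one_div_pow_le_exp hk1 s
    have h4 := Real.add_one_le_exp ((s : ℝ) / k)
    calc (1 - 1 / (k : ℝ)) ^ s * (1 + s / k) ≤ Real.exp (-(s / k)) * Real.exp (s / k) :=
          mul_le_mul h3 (by linarith) (by positivity) (Real.exp_nonneg _)
      _ = 1 := by rw [← Real.exp_add]; simp
  have haq : (s : ℝ) / k ≤ 1 - 1 / k := by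
    rw [one_sub_div hk0.ne']
    gcongr
    have : (s : ℝ) + 1 ≤ k := by exact_mod_cast hsk
    linarith
  have hx1 : (1 - 1 / (k : ℝ)) ^ s ≤ 1 :=
    pow_le_one₀ hq0 (by have : (0 : ℝ) ≤ 1 / k := by positivity
                        linarith)
  have hy : (1 - 1 / (k : ℝ)) ^ (k - s) =
      (1 - 1 / (k : ℝ)) * (1 - 1 / (k : ℝ)) ^ (k - s - 1) := by
    rw [← pow_succ']; congr 1; omega
  have hx' : (1 - 1 / (k : ℝ)) * (1 - 1 / (k : ℝ)) ^ (s - 1) = (1 - 1 / (k : ℝ)) ^ s := by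
    rw [← pow_succ']; congr 1; omega
  have ha0 : (0 : ℝ) ≤ s / k := by positivity
  have hy0 : (0 : ℝ) ≤ (1 - 1 / (k : ℝ)) ^ (k - s - 1) := pow_nonneg hq0 _
  rw [hy] at h2
  rw [guidedRandomGreedy]
  set q := 1 - 1 / (k : ℝ)
  set x := q ^ s
  set x' := q ^ (s - 1)
  set y := q ^ (k - s - 1)
  set a := (s : ℝ) / k
  set O := f T
  set L := f (T ∩ Z)
  set U := f (T ∪ Z)
  -- The coefficients of `L` and `U` are `-y * l` and `-y * u` with `0 ≤ u ≤ l`, so that the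
  -- extreme case is `L = U = w`.
  set l := q * (1 - x) with hl
  set u := q * (1 - x) - a * x + (1 - a) * (1 - x) with hu
  have hu0 : 0 ≤ u := by
    have h5 : a * (1 - x) ≤ q * (1 - x) := mul_le_mul_of_nonneg_right haq (by linarith)
    rw [hu]
    nlinarith
  have hul : u ≤ l := by
    rw [hu, hl]
    nlinarith
  have hLU : l * L + u * U ≤ (l + u) * w := by
    nlinarith [mul_le_mul_of_nonneg_left hL (sub_nonneg.2 hul),
      mul_le_mul_of_nonneg_left hU hu0]
  have hlu : (l + u) * w ≤ (l + u) * (3851 / 10000 * O) :=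
    mul_le_mul_of_nonneg_left hw (by linarith)
  have hO : 0 ≤ O := h0 T
  have h3 : y * ((l + (1 - a)) * O - (l * L + u * U)) ≤
      mean f (guidedSteps k (3 / 8) Z k) f := by
    have h4 := mul_le_mul_of_nonneg_left h1 (mul_nonneg hq0 hy0)
    have h5 := mul_le_mul_of_nonneg_left (sub_le_iff_le_add.2 hD)
      (mul_nonneg hy0 (mul_nonneg hq0 (sub_nonneg.2 hx1)))
    have h6 : q * y * (a * x' * U) = y * a * x * U := by rw [← hx']; ring
    rw [hl, hu]
    linarith
  have h7 : y * ((l + (1 - a)) * O - (l + u) * (3851 / 10000 * O)) ≤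
      y * ((l + (1 - a)) * O - (l * L + u * U)) :=
    mul_le_mul_of_nonneg_left (by linarith) hy0
  refine le_trans ?_ (h7.trans h3)
  refine (mul_le_mul_of_nonneg_right hnum hO).trans_eq ?_
  rw [hl, hu]
  ring

/-- Either the local optimum or, on average, the solution of Guided Random Greedy is good. -/
theorem ratio_mul_le_or (hf : IsSubmodular f) (h0 : ∀ S, 0 ≤ f S) (hk : 1 ≤ k) {ε : ℝ}
    (hε : 0 ≤ ε) (hε' : ε ≤ 1 / 5000) (hZ : Z.card ≤ k) (hopt : IsLocalOpt f ε k Z)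
    (hT : T.card ≤ k) :
    0.385 * f T ≤ f Z ∨ 0.385 * f T ≤ mean f (guidedRandomGreedy k (3 / 8) Z) f := by
  have hL := hopt.inter_le hf h0 hε hk hZ T
  have hU := hopt.union_add_inter_le hf h0 hε hk hZ hT
  rw [Finset.inter_comm] at hL hU
  rw [Finset.union_comm] at hU
  have hz := h0 Z
  have hεz : ε * f Z ≤ 1 / 5000 * f Z := mul_le_mul_of_nonneg_right hε' hz
  have hO := h0 T
  rcases le_total (3851 / 10000 * f T) ((1 + ε) * f Z) with h | h
  · left
    norm_num
    linarith
  · right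
    rcases hk.lt_or_eq with hk | rfl
    · have := ratio_mul_le_mean_guidedRandomGreedy hf h0 hk hT hL (by linarith) h
      norm_num
      linarith
    · have h1 := le_mean_guidedSteps (Z := Z) (i := 1) (ts := 3 / 8) hf h0 le_rfl hT
        (by rw [ceil_mul_three_eighths])
      have hD := hf.union_le_add h0 (T \ Z) (T ∩ Z)
      rw [Finset.sdiff_union_inter] at hD
      rw [guidedRandomGreedy]
      norm_num at h1 ⊢
      linarith

end Ratio

end OracleAlg

open OracleAlg in
theorem mainTheorem4 :
    ∃ (init : (n : ℕ) → ℕ → OracleAlg (Fin n) (Finset (Fin n)))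
      (c ts ε₀ : ℝ) (C : ℝ → ℝ),
      0 < c ∧ c ≤ 1 ∧ 0 ≤ ts ∧ ts ≤ 1 ∧ 0 < ε₀ ∧ ε₀ < 1 ∧
      ∀ (n k : ℕ), 1 ≤ n → 1 ≤ k →
      ∀ f : Finset (Fin n) → ℝ, IsSubmodular f → (∀ S, 0 ≤ f S) →
        -- `init` yields a feasible solution that is a `c`-approximation
        (∀ r ∈ ((init n k).run f).support,
          r.1.card ≤ k ∧ ∀ T : Finset (Fin n), T.card ≤ k → c * f T ≤ f r.1) ∧
        -- feasibility, and the number of queries on every run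
        (∀ ε : ℝ, 0 < ε → ε < 1 →
          ∀ r ∈ ((OracleAlg.warmup (init n k) ε ts k).run f).support,
            r.1.card ≤ k ∧ (r.2 : ℝ) ≤ C ε * (n * k ^ 2)) ∧
        -- the approximation ratio, in expectation
        (∀ ε : ℝ, 0 < ε → ε ≤ ε₀ →
          ∀ T : Finset (Fin n), T.card ≤ k →
            0.385 * f T ≤ (OracleAlg.warmup (init n k) ε ts k).expectedValue f) := by
  refine ⟨fun n k => streamInit k, 1 / 16, 3 / 8, 1 / 5000, fun ε => 64 / ε + 13,
    by norm_num, by norm_num, by norm_num, by norm_num, by norm_num, by norm_num, ?_⟩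
  intro n k hn hk f hf h0
  refine ⟨fun r hr => (streamInit_spec hf h0 hk hr).2, ?_, ?_⟩
  · intro ε hε _ r hr
    rw [warmup, mem_support_run_bind] at hr
    obtain ⟨s, hs, r₁, hr₁, rfl⟩ := hr
    rw [mem_support_run_bind] at hr₁
    obtain ⟨z, hz, r₂, hr₂, rfl⟩ := hr₁
    rw [mem_support_run_bind] at hr₂
    obtain ⟨g, hg, r₃, hr₃, rfl⟩ := hr₂
    simp only [mem_support_run_query, mem_support_run_ret] at hr₃
    obtain ⟨_, ⟨_, rfl, rfl⟩, rfl⟩ := hr₃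
    obtain ⟨hs1, hs2, hs3⟩ := streamInit_spec hf h0 hk hs
    have hz1 := localSearch_queries_le h0 hk hε (by norm_num) hs2 hs3 hz
    obtain ⟨hz2, -⟩ := localSearch_spec hε.le hs2 hz
    obtain ⟨hg1, hg2, -⟩ := guidedSteps_spec hg
    rw [Fintype.card_fin] at hs1 hz1 hg2
    dsimp only
    constructor
    · split_ifs
      · exact hg1
      · exact hz2
    · have hn' : (1 : ℝ) ≤ n := by exact_mod_cast hn
      have hk' : (1 : ℝ) ≤ k := by exact_mod_cast hk
      have hg3 : (g.2 : ℝ) ≤ k * (n + 1) := by exact_mod_cast hg2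
      rw [hs1]
      push_cast
      have hnk : (n : ℝ) ≤ n * k := by nlinarith
      have hnk2 : (n : ℝ) * k ≤ n * k ^ 2 := by nlinarith
      have h1k : (k : ℝ) ≤ n * k := by nlinarith
      have h4 : 1 + (n : ℝ) * (k + 2) ≤ 4 * (n * k) := by linarith
      have h5 : (k : ℝ) / (ε * (1 / 16)) * (1 + n * (k + 2)) ≤
          64 / ε * (n * k ^ 2) := by
        calc (k : ℝ) / (ε * (1 / 16)) * (1 + n * (k + 2)) ≤
            k / (ε * (1 / 16)) * (4 * (n * k)) := by gcongr
          _ = 64 / ε * (n * k ^ 2) := by field_simp; ring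
      linarith
  · intro ε hε hε' T hT
    rw [expectedValue_eq_mean, warmup, mean_bind]
    refine le_mean fun s hs => ?_
    obtain ⟨-, hs2, -⟩ := streamInit_spec hf h0 hk hs
    rw [mean_bind]
    refine le_mean fun z hz => ?_
    obtain ⟨hz1, hz2, -⟩ := localSearch_spec hε.le hs2 hz
    rw [mean_bind]
    simp only [mean]
    rcases ratio_mul_le_or hf h0 hk hε.le hε' hz1 hz2 hT with h | h
    · refine le_mean fun g _ => h.trans ?_
      split_ifs with hle
      · exact hle
      · exact le_rfl
    · refine h.trans (mean_mono fun g _ => ?_)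
      split_ifs with hle
      · exact le_rfl
      · exact (not_le.1 hle).le
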